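/- **Theorem 6.1.** *Setting.* Let $N>1$, let $m$ be Lebesgue measure on $\mathbb R^N$, let $0<\alpha\le 1$ and $\tilde\varepsilon_0>0$. For a ball $B$ put $\mathrm{osc}(f,B)=\operatorname{ess\,sup}_B f-\operatorname{ess\,inf}_B f$, and let $$|f|_\alpha=\sup_{0<\varepsilon\le\tilde\varepsilon_0}\varepsilon^{-\alpha}\int_{\mathbb R^N}\mathrm{osc}(f,B_\varepsilon(x))\,dx,\qquad \|f\|_\alpha=\|f\|_{L^1}+|f|_\alpha .$$ For a compact set $C\subset\mathbb R^N$ with $\overline{\operatorname{int}C}\neq\emptyset$, $V_\alpha$ is the space of $f\in L^1(C)$ (extended by $0$ to $\mathbb R^N$) with $|f|_\alpha<\infty$. Let $\Omega$ be a topological space with a Borel probability measure $\mathbb P$, and $\sigma:\Omega\to\Omega$ an invertible (bi-measurable), ergodic, $\mathbb P$-preserving transformation. A *random Saussol map* over $\sigma$ is a family of maps $T_\omega:C\to C$ ($\omega\in\Omega$) for which there are $\varepsilon_0>0$, countably many open sets $U_i=U_{\omega,i}\subset C$, pairwise disjoint for each $\omega$, open sets $V_i=V_{\omega,i}\supset\overline{U_i}$,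 maps $T_{\omega,i}:V_i\to\mathbb R^N$, constants $S,c>0$ and a measurable function $s$ such that, for $\mathbb P$-a.e. $\omega$ and all $i$: * (PE1) $0<s(\omega)<S$; $|T_{\omega,i}^{-1}u-T_{\omega,i}^{-1}v|\le s(\omega)|u-v|$ for $u,v\in T_{\omega,i}V_i$ with $|u-v|\le\varepsilon_0$; and $\int\log s\,d\mathbb P<0$; * (PE2) $T_\omega=T_{\omega,i}$ on $U_i$, and $T_{\omega,i}V_i\supset B_{\varepsilon_0}(T_{\omega,i}U_i)$; * (PE3) $T_{\omega,i}$ is injective and $C^1$ with $C^1$ inverse, and $|\det DT_{\omega,i}^{-1}x-\det DT_{\omega,i}^{-1}y|\le c\,|\det DT_{\omega,i}^{-1}z|\,\varepsilon^\alpha$ whenever $0<\varepsilon\le\varepsilon_0$, $z\in T_{\omega,i}V_i$ and $x,y\in B_\varepsilon(z)\cap T_{\omega,i}V_i$; * (PE4) $m(C\setminus\bigcup_iU_i)=0$; * (PE5) $\int\log\zeta\,d\mathbb P<0$, where $\zeta(\omega)=s(\omega)^\alpha+2\sup_{0<\varepsilon\le\varepsilon_0}\frac{G_\omega(\varepsilon)}{\varepsilon^{\alpha}}(S\varepsilon_0)^\alpha$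 and $$G_\omega(\varepsilon)=\sup_{x\in C}\sum_i\frac{m\big(T_{\omega,i}^{-1}B_\varepsilon(\partial T_\omega U_i)\cap B_{(S-s(\omega))\varepsilon_0}(x)\big)}{m(B_{(S-s(\omega))\varepsilon_0}(x))};$$ and such that, for the transfer operators $\mathcal L_\omega f=\sum_i\big(\tfrac{f}{|\det DT_\omega|}\big)\circ T_{\omega,i}^{-1}\,1_{T_\omega U_i}$, the map $\omega\mapsto\mathcal L_\omega$ is $\mathbb P$-continuous, i.e. $\Omega$ is a countable union of Borel sets on each of which it is continuous in the operator norm of $V_\alpha$. Logarithmic integrals may take the value $-\infty$, and their positive parts are finite. Assume moreover that $\int\log^+\|\mathcal L_\omega\|_\alpha\,d\mathbb P<\infty$. *The functions $\Theta$.* Let $\eta:\Omega\to(0,\infty)$ be measurable and let $\tilde D$ be a constant such that, for $\mathbb P$-a.e. $\omega$ and all $f\in V_\alpha$, $$\|\mathcal L_\omega f\|_\alpha\le\eta(\omega)\|f\|_\alpha+\tilde D\|f\|_{L^1}.$$ Let $\tfrac12<\xi<1$ be such that $\int\log\eta\,d\mathbb P<\log\xi$ and $\tilde D\ge\xi\tilde\varepsilon_0^{-\alpha}$.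 Write $\eta^{(j)}(\sigma^{-j}\omega)=\eta(\sigma^{-1}\omega)\cdots\eta(\sigma^{-j}\omega)$, and for a.e. $\omega$ let $j_0(\omega)$ be such that $\eta^{(j)}(\sigma^{-j}\omega)<\xi^j$ for all $j\ge 1$ with $j\ge j_0(\omega)$. Put $$\theta(\omega)=\max\Big(1,\max_{1\le j\le j_0(\omega)}\frac{\eta^{(j)}(\sigma^{-j}\omega)}{\xi^j}\Big),\qquad \Theta(\omega)=\tilde D\,m(C)\Big(1+\frac{\theta(\omega)}{1-\xi}\Big).$$ *Statement.* Assume $m(C)\ge 1$. Let $r$ be the number of ergodic skew-product ACIPs, that is, of probability measures on $\Omega\times C$ that are absolutely continuous with respect to $\mathbb P\times m$, and invariant and ergodic under $F(\omega,x)=(\sigma\omega,T_\omega x)$. Then, for every function $\Theta$ obtained in this way, $r$ is finite and $$r\le\frac{m(C)}{\gamma_N}\ \operatorname*{ess\,inf}_{\omega\in\Omega}\ \Theta(\omega)^{N/\alpha},$$ where $\gamma_N$ is the volume of the unit ball of $\mathbb R^N$. -/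

import Mathlib

open MeasureTheory Set Topology
open scoped ENNReal

namespace Saussol

/-- Euclidean `N`-space. -/
abbrev E (N : ℕ) : Type := EuclideanSpace ℝ (Fin N)

/-! ### The space of bounded oscillation

Elements of `L¹(C)` are represented by functions on the whole space that vanish almost everywhere
outside `C`. All the quantities below only depend on the almost-everywhere class. -/

/-- The oscillation `ess sup_A f - ess inf_A f`, with value `∞` if `f` is essentially unbounded
on `A`. -/
noncomputable def osc {N : ℕ} (f : E N → ℝ) (A : Set (E N)) : ℝ≥0∞ :=
  (essSup (fun x => (f x : EReal)) (volume.restrict A) -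
    essInf (fun x => (f x : EReal)) (volume.restrict A)).toENNReal

/-- The `α`-seminorm `|f|_α = sup_{0 < ε ≤ e} ε^{-α} ∫ osc(f, B_ε(x)) dx`. -/
noncomputable def oscSeminorm {N : ℕ} (α e : ℝ) (f : E N → ℝ) : ℝ≥0∞ :=
  ⨆ ε ∈ Ioc (0 : ℝ) e, ENNReal.ofReal (ε ^ (-α)) * ∫⁻ x, osc f (Metric.ball x ε)

/-- The norm `‖f‖_α = ‖f‖_{L¹} + |f|_α`. -/
noncomputable def oscNorm {N : ℕ} (α e : ℝ) (f : E N → ℝ) : ℝ≥0∞ :=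
  eLpNorm f 1 volume + oscSeminorm α e f

/-- Membership in the space `V_α` of functions of bounded oscillation on `C`. -/
structure MemV {N : ℕ} (C : Set (E N)) (α e : ℝ) (f : E N → ℝ) : Prop where
  integrable : Integrable f volume
  eq_zero : ∀ᵐ x, x ∉ C → f x = 0
  finite : oscSeminorm α e f < ∞

/-! ### Logarithmic integrals -/

/-- `∫ log φ dP < log a`, where the integral may be `-∞` but its positive part has to be finite:
the integral of the positive part of `log (φ / a)` is smaller than that of the negative part. -/
def LogIntegralLT {Ω : Type*} [MeasurableSpace Ω] (P : Measure Ω) (φ : Ω → ℝ≥0∞) (a : ℝ≥0∞) :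
    Prop :=
  AEMeasurable φ P ∧
    ∫⁻ ω, (ENNReal.log (φ ω / a)).toENNReal ∂P < ∫⁻ ω, (-ENNReal.log (φ ω / a)).toENNReal ∂P

/-! ### Random Saussol maps -/

/-- A family of self-maps `T ω` of `C`, with the sets `U ω i ⊆ V ω i` and the branch maps
`branch ω i`, of which only the values on `V ω i` matter. The sets may depend on `ω` and
may be empty. -/
structure BranchedFamily (Ω ι : Type*) {N : ℕ} (C : Set (E N)) where
  T : Ω → C → C
  U : Ω → ι → Set (E N)
  V : Ω → ι → Set (E N)
  branch : Ω → ι → E N → E N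

namespace BranchedFamily

variable {Ω ι : Type*} {N : ℕ} {C : Set (E N)}

/-- The inverse of the `i`-th branch, defined on `branch ω i '' V ω i`. -/
noncomputable def inv (Φ : BranchedFamily Ω ι C) (ω : Ω) (i : ι) : E N → E N :=
  Function.invFunOn (Φ.branch ω i) (Φ.V ω i)

/-- The determinant of the derivative of the inverse branch. -/
noncomputable def invDet (Φ : BranchedFamily Ω ι C) (ω : Ω) (i : ι) (x : E N) : ℝ :=
  (fderiv ℝ (Φ.inv ω i) x).det

/-- The transfer operator
`(L_ω f)(x) = ∑_i 1_{T_ω U_i}(x) · f(y) / |det DT_ω(y)|`, with `y = T_{ω,i}⁻¹ x`. -/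
noncomputable def transfer (Φ : BranchedFamily Ω ι C) (ω : Ω) (f : E N → ℝ) (x : E N) : ℝ :=
  ∑' i, (Φ.branch ω i '' Φ.U ω i).indicator
    (fun x => |(fderiv ℝ (Φ.branch ω i) (Φ.inv ω i x)).det|⁻¹ * f (Φ.inv ω i x)) x

/-- The operator norm of the transfer operator on `V_α` (`∞` if it is unbounded). -/
noncomputable def transferNorm (Φ : BranchedFamily Ω ι C) (α e : ℝ) (ω : Ω) : ℝ≥0∞ :=
  sInf {M : ℝ≥0∞ | ∀ f, MemV C α e f → oscNorm α e (Φ.transfer ω f) ≤ M * oscNorm α e f}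

/-- `ω ↦ L_ω` is `ℙ`-continuous: `Ω` is a countable union of Borel sets on each of which the map
is continuous for the operator norm on `V_α`. -/
def IsPContinuous [TopologicalSpace Ω] [MeasurableSpace Ω] (Φ : BranchedFamily Ω ι C)
    (α e : ℝ) : Prop :=
  ∃ A : ℕ → Set Ω, (∀ n, MeasurableSet (A n)) ∧ (⋃ n, A n) = univ ∧
    ∀ n, ∀ ω₀ ∈ A n, ∀ δ > (0 : ℝ), ∀ᶠ ω in 𝓝[A n] ω₀, ∀ f, MemV C α e f →
      oscNorm α e (Φ.transfer ω f - Φ.transfer ω₀ f) ≤ ENNReal.ofReal δ * oscNorm α e f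

/-- `G_{ω,ε₀}(x, ε)`, the sum over the branches of the relative measures of
`T_{ω,i}⁻¹ B_ε(∂ T_ω U_i)` in the ball of radius `(S - s(ω)) ε₀` about `x`. -/
noncomputable def gAt (Φ : BranchedFamily Ω ι C) (ε₀ : ℝ) (s : Ω → ℝ) (S : ℝ) (ω : Ω)
    (x : E N) (ε : ℝ) : ℝ≥0∞ :=
  ∑' i, volume ((Φ.V ω i ∩ Φ.branch ω i ⁻¹'
        Metric.thickening ε (frontier (Φ.branch ω i '' Φ.U ω i))) ∩
      Metric.ball x ((S - s ω) * ε₀)) /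
    volume (Metric.ball x ((S - s ω) * ε₀))

/-- `G_{ω,ε₀}(ε) = sup_{x ∈ C} G_{ω,ε₀}(x, ε)`. -/
noncomputable def gSup (Φ : BranchedFamily Ω ι C) (ε₀ : ℝ) (s : Ω → ℝ) (S : ℝ) (ω : Ω)
    (ε : ℝ) : ℝ≥0∞ :=
  ⨆ x ∈ C, Φ.gAt ε₀ s S ω x ε

/-- `ζ_{ε₀}(ω) = s(ω)^α + 2 sup_{0 < ε ≤ ε₀} (G_{ω,ε₀}(ε) / ε^α) (S ε₀)^α`. -/
noncomputable def zeta (Φ : BranchedFamily Ω ι C) (α ε₀ : ℝ) (s : Ω → ℝ) (S : ℝ) (ω : Ω) :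
    ℝ≥0∞ :=
  ENNReal.ofReal (s ω ^ α) +
    2 * (⨆ ε ∈ Ioc (0 : ℝ) ε₀, Φ.gSup ε₀ s S ω ε / ENNReal.ofReal (ε ^ α)) *
      ENNReal.ofReal ((S * ε₀) ^ α)

/-- The family is a random Saussol map with exponent `α`, scale `ε₀`, contraction rates `s` of the
inverse branches, bounded by `S`, and Hölder constant `c` of the determinants. The number `e` is
the scale used in the norm of `V_α`; different values give equivalent norms. -/
structure IsRandomSaussol [TopologicalSpace Ω] [MeasurableSpace Ω] (Φ : BranchedFamily Ω ι C)
    (P : Measure Ω) (α ε₀ e : ℝ) (s : Ω → ℝ) (S c : ℝ) : Prop where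
  isOpen_U : ∀ ω i, IsOpen (Φ.U ω i)
  isOpen_V : ∀ ω i, IsOpen (Φ.V ω i)
  U_subset : ∀ ω i, Φ.U ω i ⊆ C
  disjoint_U : ∀ ω i j, i ≠ j → Disjoint (Φ.U ω i) (Φ.U ω j)
  closure_U : ∀ ω i, closure (Φ.U ω i) ⊆ Φ.V ω i
  -- average expansion
  S_pos : 0 < S
  s_bounds : ∀ᵐ ω ∂P, 0 < s ω ∧ s ω < S
  expanding : ∀ᵐ ω ∂P, ∀ i, ∀ x ∈ Φ.V ω i, ∀ y ∈ Φ.V ω i,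
    dist (Φ.branch ω i x) (Φ.branch ω i y) ≤ ε₀ →
      dist x y ≤ s ω * dist (Φ.branch ω i x) (Φ.branch ω i y)
  log_s_neg : LogIntegralLT P (fun ω => ENNReal.ofReal (s ω)) 1
  -- extension of the branches
  branch_eq : ∀ᵐ ω ∂P, ∀ i, ∀ x : C, (x : E N) ∈ Φ.U ω i → (Φ.T ω x : E N) = Φ.branch ω i x
  thickening_subset : ∀ᵐ ω ∂P, ∀ i,
    Metric.thickening ε₀ (Φ.branch ω i '' Φ.U ω i) ⊆ Φ.branch ω i '' Φ.V ω i
  -- regularity of the branches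
  contDiffOn_branch : ∀ᵐ ω ∂P, ∀ i, ContDiffOn ℝ 1 (Φ.branch ω i) (Φ.V ω i)
  injOn_branch : ∀ᵐ ω ∂P, ∀ i, InjOn (Φ.branch ω i) (Φ.V ω i)
  contDiffOn_inv : ∀ᵐ ω ∂P, ∀ i, ContDiffOn ℝ 1 (Φ.inv ω i) (Φ.branch ω i '' Φ.V ω i)
  c_pos : 0 < c
  holder_det : ∀ᵐ ω ∂P, ∀ i, ∀ ε ∈ Ioc (0 : ℝ) ε₀, ∀ z ∈ Φ.branch ω i '' Φ.V ω i,
    ∀ x ∈ Metric.ball z ε ∩ Φ.branch ω i '' Φ.V ω i,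
    ∀ y ∈ Metric.ball z ε ∩ Φ.branch ω i '' Φ.V ω i,
      |Φ.invDet ω i x - Φ.invDet ω i y| ≤ c * |Φ.invDet ω i z| * ε ^ α
  -- the pieces exhaust `C`
  covers : ∀ᵐ ω ∂P, volume (C \ ⋃ i, Φ.U ω i) = 0
  -- control of the boundaries
  log_zeta_neg : LogIntegralLT P (Φ.zeta α ε₀ s S) 1
  pContinuous : Φ.IsPContinuous α e

/-- The skew product `F(ω, x) = (σ ω, T_ω x)` on `Ω × C`. -/
def skewProduct (Φ : BranchedFamily Ω ι C) (σ : Ω → Ω) (p : Ω × C) : Ω × C :=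
  (σ p.1, Φ.T p.1 p.2)

/-- The ergodic skew-product ACIPs: the probability measures on `Ω × C` that are invariant and
ergodic for the skew product and absolutely continuous with respect to `P × m`. -/
def ergodicACIPs [MeasurableSpace Ω] (Φ : BranchedFamily Ω ι C) (σ : Ω → Ω) (P : Measure Ω) :
    Set (Measure (Ω × C)) :=
  {μ | IsProbabilityMeasure μ ∧ Ergodic (Φ.skewProduct σ) μ ∧
    μ ≪ P.prod ((volume : Measure (E N)).comap (fun x : C => (x : E N)))}

/-- `η` and the constant `D` are coefficients of a Lasota-Yorke inequality
`‖L_ω f‖_α ≤ η(ω) ‖f‖_α + D ‖f‖_{L¹}` on `V_α`, valid for almost every `ω`. -/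
def LasotaYorke [MeasurableSpace Ω] (Φ : BranchedFamily Ω ι C) (P : Measure Ω) (α e : ℝ)
    (η : Ω → ℝ) (D : ℝ) : Prop :=
  ∀ᵐ ω ∂P, ∀ f, MemV C α e f →
    oscNorm α e (Φ.transfer ω f) ≤
      ENNReal.ofReal (η ω) * oscNorm α e f + ENNReal.ofReal D * eLpNorm f 1 volume

end BranchedFamily

/-! ### The bound `Θ` -/

/-- `η^{(j)}(σ^{-j} ω) = η(σ^{-1} ω) η(σ^{-2} ω) ⋯ η(σ^{-j} ω)`. -/
def backProd {Ω : Type*} [MeasurableSpace Ω] (σ : Ω ≃ᵐ Ω) (η : Ω → ℝ) (j : ℕ) (ω : Ω) : ℝ :=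
  ∏ t ∈ Finset.Icc 1 j, η (σ.symm^[t] ω)

/-- `θ(ω) = max (1, max_{1 ≤ j ≤ j₀(ω)} η^{(j)}(σ^{-j} ω) / ξ^j)`. -/
noncomputable def theta {Ω : Type*} [MeasurableSpace Ω] (σ : Ω ≃ᵐ Ω) (η : Ω → ℝ) (ξ : ℝ)
    (j₀ : Ω → ℕ) (ω : Ω) : ℝ :=
  (Finset.Icc 1 (j₀ ω)).fold max 1 (fun j => backProd σ η j ω / ξ ^ j)

/-- `Θ(ω) = D m(C) (1 + θ(ω) / (1 - ξ))`. -/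
noncomputable def bigTheta {Ω : Type*} [MeasurableSpace Ω] {N : ℕ} (C : Set (E N))
    (σ : Ω ≃ᵐ Ω) (η : Ω → ℝ) (D ξ : ℝ) (j₀ : Ω → ℕ) (ω : Ω) : ℝ :=
  D * volume.real C * (1 + theta σ η ξ j₀ ω / (1 - ξ))

/-- `Θ` is one of the functions `D m(C) (1 + θ(ω) / (1 - ξ))` that bound the norms of the invariant
densities: it is formed from coefficients `η`, `D` of a Lasota-Yorke inequality with
`D ≥ ξ e^{-α}`, from a number `ξ ∈ (1/2, 1)` with `∫ log η dP < log ξ`, and from times `j₀(ω)`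
after which the backward products of `η` are smaller than the powers of `ξ`. -/
def IsTheta {Ω ι : Type*} [MeasurableSpace Ω] {N : ℕ} {C : Set (E N)}
    (Φ : BranchedFamily Ω ι C) (P : Measure Ω) (σ : Ω ≃ᵐ Ω) (α e : ℝ) (Θ : Ω → ℝ) : Prop :=
  ∃ (η : Ω → ℝ) (D ξ : ℝ) (j₀ : Ω → ℕ),
    Measurable η ∧ (∀ ω, 0 < η ω) ∧ Φ.LasotaYorke P α e η D ∧
    1 / 2 < ξ ∧ ξ < 1 ∧ ξ * e ^ (-α) ≤ D ∧
    LogIntegralLT P (fun ω => ENNReal.ofReal (η ω)) (ENNReal.ofReal ξ) ∧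
    (∀ᵐ ω ∂P, ∀ j, 1 ≤ j → j₀ ω ≤ j → backProd σ η j ω < ξ ^ j) ∧
    Θ = bigTheta C σ η D ξ j₀

end Saussol

/-! Distinct ergodic ACIPs are mutually singular, so over almost every `ω` their fibre densities
have essentially disjoint supports in `C`. It is enough to show that each fibre density is positive
almost everywhere on some ball of radius `Θ(ω)^{-1/α}`. These balls are then disjoint and contained
in `C` up to null sets, and comparing volumes bounds their number for almost every `ω`, hence by the
essential infimum.

Such a ball exists once a probability density `f` has `|f|_α < Θ(ω)`
(`exists_ball_ae_pos_of_oscSeminorm_lt`). At scale `ε = Θ(ω)^{-1/α}` the integral of `osc(f,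
B_ε(x))` is then smaller than 1. If `f` were positive almost everywhere on no ball of radius `ε`,
then `f(x) ≤ osc(f, B_ε(x))` would hold almost everywhere, contradicting `∫ f = 1`.

The main point is to bound `|H_ω|_α` for a fibre density `H_ω` that is a priori only in `L¹`
(`IsDensity.ae_oscSeminorm_le`). Invariance gives `L_ω H_ω = H_{σω}`. Choose `φ ∈ V_α` that is
`L¹`-close to `H_ω`. By Poincaré recurrence for `σ⁻¹`, the same `φ` is equally close to
`H_{σ^{-n}ω}` for infinitely many `n`. Pushing `φ` forward from `σ^{-n}ω` to `ω` keeps it close to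
`H_ω`, since transfer operators contract `L¹`, while the iterated Lasota-Yorke inequality bounds its
norm by `θ ξ^n ‖φ‖_α + D θ/(1-ξ) ‖φ‖_{L¹}`. As `φ` is fixed, a large `n` removes the first term.
Lower semicontinuity of the seminorm then gives `|H_ω|_α ≤ D θ(ω)/(1-ξ) < Θ(ω)`. -/

namespace Saussol

/-! ### Oscillation: semicontinuity and positivity on balls -/

/-- Replaces the extended-real essential bounds by pointwise inequalities on a set of full measure,
which survive limits and countable intersections. -/
theorem osc_le_iff {N : ℕ} (f : E N → ℝ) (A : Set (E N)) {c : ℝ} (hc : 0 ≤ c) :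
    osc f A ≤ ENNReal.ofReal c ↔
      ∃ G : Set (E N), (∀ᵐ x ∂volume.restrict A, x ∈ G) ∧ ∀ y ∈ G, ∀ z ∈ G, f y - f z ≤ c := by
  constructor
  · intro h
    refine ⟨{x | essInf (fun x => (f x : EReal)) (volume.restrict A) ≤ f x ∧
      (f x : EReal) ≤ essSup (fun x => (f x : EReal)) (volume.restrict A)}, ?_, ?_⟩
    · filter_upwards [ae_le_essSup (μ := volume.restrict A) (f := fun x => (f x : EReal)),
        ae_essInf_le (μ := volume.restrict A) (f := fun x => (f x : EReal))] with x h1 h2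
      exact ⟨h2, h1⟩
    · rintro y ⟨_, hy⟩ z ⟨hz, _⟩
      have h1 := EReal.sub_le_sub hy hz
      have h2 := (EReal.toENNReal_le_toENNReal h1).trans h
      rw [← EReal.coe_sub, EReal.toENNReal_of_ne_top (EReal.coe_ne_top _), EReal.toReal_coe,
        ENNReal.ofReal_le_ofReal_iff hc] at h2
      exact h2
  · rintro ⟨G, hG, h⟩
    unfold osc
    -- On a null set `essSup` is `⊥` and `essInf` is `⊤`, so the truncated difference is 0.
    -- Otherwise `G` has a point, which excludes `b = ⊤`.
    rcases eq_or_ne (volume.restrict A) 0 with h0 | h0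
    · simp [h0, essSup, essInf]
    set b := essSup (fun x => (f x : EReal)) (volume.restrict A)
    set a := essInf (fun x => (f x : EReal)) (volume.restrict A)
    have hb : ∀ z ∈ G, b ≤ ((f z + c : ℝ) : EReal) := fun z hz => by
      refine essSup_le_of_ae_le _ ?_
      filter_upwards [hG] with y hy
      exact EReal.coe_le_coe_iff.2 (by linarith [h y hy z hz])
    have : (ae (volume.restrict A)).NeBot := ae_neBot.2 h0
    obtain ⟨z₀, hz₀⟩ := hG.exists
    have hbt : b ≠ ⊤ := fun h => EReal.coe_ne_top _ (top_le_iff.1 (h ▸ hb z₀ hz₀))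
    have key : b - a ≤ (c : EReal) := by
      induction hbb : b with
      | bot => simp
      | top => exact absurd hbb hbt
      | coe b' =>
        have ha : ((b' - c : ℝ) : EReal) ≤ a := by
          refine le_essInf_of_ae_le _ ?_
          filter_upwards [hG] with z hz
          have := hb z hz
          rw [hbb, EReal.coe_le_coe_iff] at this
          exact EReal.coe_le_coe_iff.2 (by linarith)
        induction haa : a with
        | bot => rw [haa] at ha; exact absurd (le_bot_iff.1 ha) (EReal.coe_ne_bot _)
        | top => simp
        | coe a' =>
          rw [haa, EReal.coe_le_coe_iff] at ha
          rw [← EReal.coe_sub, EReal.coe_le_coe_iff]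
          linarith
    refine (EReal.toENNReal_le_toENNReal key).trans ?_
    rw [EReal.toENNReal_of_ne_top (EReal.coe_ne_top _), EReal.toReal_coe]

theorem osc_le_of_forall {N : ℕ} {f : E N → ℝ} {A : Set (E N)} {X : ℝ≥0∞}
    (h : ∀ c : ℝ, 0 ≤ c → X < ENNReal.ofReal c →
      ∃ G : Set (E N), (∀ᵐ x ∂volume.restrict A, x ∈ G) ∧ ∀ y ∈ G, ∀ z ∈ G, f y - f z ≤ c) :
    osc f A ≤ X := by
  refine le_of_forall_gt_imp_ge_of_dense fun a ha => ?_
  induction a with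
  | top => exact le_top
  | coe r =>
    have := (osc_le_iff f A r.2).2 (h r r.2 (by simpa using ha))
    simpa using this

theorem osc_mono {N : ℕ} (f : E N → ℝ) {A B : Set (E N)} (h : A ⊆ B) : osc f A ≤ osc f B := by
  refine osc_le_of_forall fun c hc hX => ?_
  obtain ⟨G, hG, hG'⟩ := (osc_le_iff f B hc).1 hX.le
  exact ⟨G, ae_mono (Measure.restrict_mono h le_rfl) hG, hG'⟩

/-- If the liminf is below `c`, infinitely many `u k` oscillate by at most `c` off a null set, and
the inequality passes to the limit along these `k`. -/
theorem osc_le_liminf {N : ℕ} {u : ℕ → E N → ℝ} {h : E N → ℝ} (A : Set (E N))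
    (hu : ∀ᵐ x, Filter.Tendsto (fun k => u k x) Filter.atTop (𝓝 (h x))) :
    osc h A ≤ Filter.liminf (fun k => osc (u k) A) Filter.atTop := by
  refine osc_le_of_forall fun c hc hX => ?_
  have hfr := Filter.frequently_lt_of_liminf_lt (by isBoundedDefault) hX
  choose! G hG hG' using fun k (hk : osc (u k) A ≤ ENNReal.ofReal c) => (osc_le_iff (u k) A hc).1 hk
  refine ⟨{x | Filter.Tendsto (fun k => u k x) Filter.atTop (𝓝 (h x)) ∧
    ∀ k, osc (u k) A ≤ ENNReal.ofReal c → x ∈ G k}, ?_, ?_⟩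
  · have h2 : ∀ᵐ x ∂volume.restrict A, ∀ k, osc (u k) A ≤ ENNReal.ofReal c → x ∈ G k := by
      rw [ae_all_iff]
      intro k
      by_cases hk : osc (u k) A ≤ ENNReal.ofReal c
      · filter_upwards [hG k hk] with x hx _ using hx
      · exact Filter.Eventually.of_forall fun x h => absurd h hk
    filter_upwards [ae_restrict_of_ae hu, h2] with x h1 h2 using ⟨h1, h2⟩
  · rintro y ⟨hy, hy'⟩ z ⟨hz, hz'⟩
    refine le_of_tendsto_of_frequently (hy.sub hz) (hfr.mono fun k hk => ?_)
    exact hG' k hk.le y (hy' k hk.le) z (hz' k hk.le)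

/-- Any two points of an open ball lie in a slightly smaller concentric ball, and that one is
contained in the original-sized balls about nearby centres. This yields the measurability in the
centre that Fatou's lemma needs. -/
theorem lowerSemicontinuous_osc_ball {N : ℕ} (f : E N → ℝ) (ε : ℝ) :
    LowerSemicontinuous fun x => osc f (Metric.ball x ε) := by
  intro x a ha
  have hsup : osc f (Metric.ball x ε) ≤ ⨆ n : ℕ, osc f (Metric.ball x (ε - 1 / (n + 1))) := by
    refine osc_le_of_forall fun c hc hX => ?_
    choose G hG hG' using fun n : ℕ => (osc_le_iff f (Metric.ball x (ε - 1 / (n + 1))) hc).1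
      ((le_iSup (fun n : ℕ => osc f (Metric.ball x (ε - 1 / (n + 1)))) n).trans hX.le)
    refine ⟨{y | y ∈ Metric.ball x ε ∧ ∀ n : ℕ, y ∈ Metric.ball x (ε - 1 / (n + 1)) → y ∈ G n},
      ?_, ?_⟩
    · have h2 : ∀ᵐ y, ∀ n : ℕ, y ∈ Metric.ball x (ε - 1 / (n + 1)) → y ∈ G n :=
        ae_all_iff.2 fun n => (ae_restrict_iff' Metric.isOpen_ball.measurableSet).1 (hG n)
      filter_upwards [ae_restrict_of_ae h2, ae_restrict_mem Metric.isOpen_ball.measurableSet]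
        with y h1 h2 using ⟨h2, h1⟩
    · rintro y ⟨hy, hy'⟩ z ⟨hz, hz'⟩
      rw [Metric.mem_ball] at hy hz
      obtain ⟨n, hn⟩ := exists_nat_one_div_lt (sub_pos.2 (max_lt hy hz))
      have h1 := le_max_left (dist y x) (dist z x)
      have h2 := le_max_right (dist y x) (dist z x)
      exact hG' n y (hy' n (by rw [Metric.mem_ball]; linarith)) z
        (hz' n (by rw [Metric.mem_ball]; linarith))
  obtain ⟨n, hn⟩ := lt_iSup_iff.1 (ha.trans_le hsup)
  filter_upwards [Metric.ball_mem_nhds x (Nat.one_div_pos_of_nat (α := ℝ) (n := n))] with y hy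
  refine hn.trans_le (osc_mono f (Metric.ball_subset ?_))
  rw [Metric.mem_ball, dist_comm] at hy
  linarith

theorem measurable_osc_ball {N : ℕ} (f : E N → ℝ) (ε : ℝ) :
    Measurable fun x => osc f (Metric.ball x ε) :=
  (lowerSemicontinuous_osc_ball f ε).measurable

theorem oscSeminorm_le_liminf {N : ℕ} {α e : ℝ} {u : ℕ → E N → ℝ} {h : E N → ℝ}
    (hu : ∀ᵐ x, Filter.Tendsto (fun k => u k x) Filter.atTop (𝓝 (h x))) :
    oscSeminorm α e h ≤ Filter.liminf (fun k => oscSeminorm α e (u k)) Filter.atTop := by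
  refine iSup₂_le fun ε hε => ?_
  calc ENNReal.ofReal (ε ^ (-α)) * ∫⁻ x, osc h (Metric.ball x ε)
      ≤ ENNReal.ofReal (ε ^ (-α)) *
          ∫⁻ x, Filter.liminf (fun k => osc (u k) (Metric.ball x ε)) Filter.atTop := by
        gcongr with x
        exact osc_le_liminf _ hu
    _ = ∫⁻ x, Filter.liminf
          (fun k => ENNReal.ofReal (ε ^ (-α)) * osc (u k) (Metric.ball x ε)) Filter.atTop := by
        rw [← lintegral_const_mul _ (Measurable.liminf fun k => measurable_osc_ball _ _)]
        congr 1 with x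
        exact (ENNReal.liminf_const_mul_of_ne_top (f := Filter.atTop)
          (u := fun k => osc (u k) (Metric.ball x ε)) ENNReal.ofReal_ne_top).symm
    _ ≤ Filter.liminf (fun k => ∫⁻ x, ENNReal.ofReal (ε ^ (-α)) *
          osc (u k) (Metric.ball x ε)) Filter.atTop :=
        lintegral_liminf_le fun k => (measurable_osc_ball _ _).const_mul _
    _ ≤ _ := by
        refine Filter.liminf_le_liminf (Filter.Eventually.of_forall fun k => ?_)
        rw [lintegral_const_mul _ (measurable_osc_ball _ _)]
        exact le_iSup₂ (f := fun ε (_ : ε ∈ Ioc (0 : ℝ) e) =>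
          ENNReal.ofReal (ε ^ (-α)) * ∫⁻ x, osc (u k) (Metric.ball x ε)) ε hε

theorem exists_ball_ae_pos {N : ℕ} {f : E N → ℝ} {ε : ℝ} (hε : 0 < ε)
    (h : ∫⁻ x, osc f (Metric.ball x ε) < ∫⁻ x, ENNReal.ofReal (f x)) :
    ∃ x, ∀ᵐ y ∂volume.restrict (Metric.ball x ε), 0 < f y := by
  by_contra hne
  rw [not_exists] at hne
  refine h.not_ge (lintegral_mono_ae ?_)
  -- Bounds on `f` over a ball hold only almost everywhere and say nothing about its centre. For
  -- fixed rational `q`, however, the set of `x` with `osc < q < f x` is locally null: near each of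
  -- its points `f ≤ q` almost everywhere, because `f` is nonpositive somewhere in the good set `G`.
  have hq : ∀ᵐ x, ∀ q : ℚ, 0 ≤ q → osc f (Metric.ball x ε) < ENNReal.ofReal q → f x ≤ q := by
    refine ae_all_iff.2 fun q => ?_
    by_cases hq0 : 0 ≤ q
    swap
    · exact Filter.Eventually.of_forall fun x h => absurd h hq0
    refine measure_null_of_locally_null _ fun x hx => ?_
    simp only [mem_compl_iff, mem_ofPred_eq, Classical.not_imp, not_le] at hx
    obtain ⟨-, hx, -⟩ := hx
    obtain ⟨G, hG, hG'⟩ := (osc_le_iff f _ (Rat.cast_nonneg.2 hq0)).1 hx.le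
    have hfr : ∃ᶠ y in ae (volume.restrict (Metric.ball x ε)), ¬ 0 < f y :=
      Filter.not_eventually.1 (hne x)
    obtain ⟨z, hz, hzG⟩ := (hfr.and_eventually hG).exists
    have hle : ∀ᵐ y ∂volume.restrict (Metric.ball x ε), f y ≤ q := by
      filter_upwards [hG] with y hy
      linarith [hG' y hy z hzG]
    rw [ae_restrict_iff' Metric.isOpen_ball.measurableSet, ae_iff] at hle
    refine ⟨_, Filter.inter_mem self_mem_nhdsWithin
      (mem_nhdsWithin_of_mem_nhds (Metric.ball_mem_nhds x hε)), ?_⟩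
    refine measure_mono_null ?_ hle
    rintro y ⟨hy, hyx⟩
    simp only [mem_compl_iff, mem_ofPred_eq, Classical.not_imp] at hy ⊢
    exact ⟨hyx, hy.2.2⟩
  filter_upwards [hq] with x hx
  by_contra! hlt
  obtain ⟨q, hq0, h1, h2⟩ := ENNReal.lt_iff_exists_rat_btwn.1 hlt
  have h3 := hx q hq0 h1
  exact h2.not_ge (ENNReal.ofReal_le_ofReal h3)

/-- A probability density with `|f|_α < T` is positive on a ball of radius `T^{-1/α}`. -/
theorem exists_ball_ae_pos_of_oscSeminorm_lt {N : ℕ} {α e T : ℝ} (hα : 0 < α) (he : 0 < e)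
    (hT : e ^ (-α) ≤ T) {f : E N → ℝ} (hf : ∫⁻ x, ENNReal.ofReal (f x) = 1)
    (h : oscSeminorm α e f < ENNReal.ofReal T) :
    ∃ x, ∀ᵐ y ∂volume.restrict (Metric.ball x (T ^ (-1 / α))), 0 < f y := by
  have hT0 : 0 < T := (Real.rpow_pos_of_pos he _).trans_le hT
  have hpos : 0 < T ^ (-1 / α) := Real.rpow_pos_of_pos hT0 _
  have hle : T ^ (-1 / α) ≤ e := by
    have := Real.rpow_le_rpow_of_nonpos (Real.rpow_pos_of_pos he _) hT
      (z := -1 / α) (by rw [neg_div]; simp; positivity)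
    rwa [← Real.rpow_mul he.le, show -α * (-1 / α) = 1 by field_simp, Real.rpow_one] at this
  refine exists_ball_ae_pos hpos ?_
  -- At `ε = T^{-1/α}` the weight `ε^{-α}` equals `T`, so the oscillation integral is less than 1.
  have h1 := (le_iSup₂ (f := fun ε (_ : ε ∈ Ioc (0 : ℝ) e) =>
          ENNReal.ofReal (ε ^ (-α)) * ∫⁻ x, osc f (Metric.ball x ε)) _ ⟨hpos, hle⟩).trans_lt h
  rw [← Real.rpow_mul hT0.le, show -1 / α * -α = 1 by field_simp, Real.rpow_one] at h1
  rw [hf]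
  by_contra! h2
  exact h1.not_ge (le_mul_of_one_le_right' h2)


/-! ### Density of `V_α` in `L¹(C)` -/

/-- The oscillation on an `ε`-ball is at most `2Kε`, and it vanishes if the ball misses `C`. The
remaining factor `ε^{1-α}` is bounded because `α ≤ 1`. -/
theorem memV_of_lipschitz {N : ℕ} {C : Set (E N)} (hC : IsCompact C) {α e : ℝ} (hα' : α ≤ 1)
    {f : E N → ℝ} {K : NNReal} (hf : LipschitzWith K f) (h0 : ∀ x, x ∉ C → f x = 0) :
    MemV C α e f where
  integrable := hf.continuous.integrable_of_hasCompactSupport (HasCompactSupport.intro hC h0)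
  eq_zero := Filter.Eventually.of_forall h0
  finite := by
    have key : ∀ ε ∈ Ioc (0 : ℝ) e, ENNReal.ofReal (ε ^ (-α)) * ∫⁻ x, osc f (Metric.ball x ε) ≤
        ENNReal.ofReal (e ^ (1 - α)) * (ENNReal.ofReal (2 * K) * volume (Metric.cthickening e C)) := by
      rintro ε ⟨hε, hεe⟩
      have h1 : ∫⁻ x, osc f (Metric.ball x ε) ≤
          ENNReal.ofReal (2 * K * ε) * volume (Metric.cthickening e C) := by
        rw [← setLIntegral_const, ← lintegral_indicator Metric.isClosed_cthickening.measurableSet]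
        refine lintegral_mono fun x => ?_
        by_cases hx : x ∈ Metric.cthickening e C
        · rw [indicator_of_mem hx]
          refine (osc_le_iff f _ (by positivity)).2 ⟨Metric.ball x ε,
            ae_restrict_mem Metric.isOpen_ball.measurableSet, fun y hy z hz => ?_⟩
          have := hf.dist_le_mul y z
          rw [Real.dist_eq] at this
          have h2 : dist y z ≤ 2 * ε := by
            linarith [dist_triangle_right y z x, Metric.mem_ball.1 hy, Metric.mem_ball.1 hz]
          have h3 : (K : ℝ) * dist y z ≤ K * (2 * ε) := by gcongr
          linarith [le_abs_self (f y - f z)]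
        · rw [indicator_of_notMem hx]
          rw [← ENNReal.ofReal_zero]
          have hz : ∀ y ∈ Metric.ball x ε, f y = 0 := fun y hy => h0 y fun hyC => hx <| by
            refine Metric.mem_cthickening_of_dist_le x y e C hyC ?_
            rw [dist_comm]
            exact (Metric.mem_ball.1 hy).le.trans hεe
          refine (osc_le_iff f _ le_rfl).2 ⟨Metric.ball x ε,
            ae_restrict_mem Metric.isOpen_ball.measurableSet, fun y hy z hz' => ?_⟩
          rw [hz y hy, hz z hz', sub_zero]
      calc _ ≤ ENNReal.ofReal (ε ^ (-α)) *
            (ENNReal.ofReal (2 * K * ε) * volume (Metric.cthickening e C)) := by gcongr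
        _ = ENNReal.ofReal (ε ^ (1 - α)) *
            (ENNReal.ofReal (2 * K) * volume (Metric.cthickening e C)) := by
            rw [ENNReal.ofReal_mul (by positivity), show 1 - α = -α + 1 by ring,
              Real.rpow_add hε, Real.rpow_one, ENNReal.ofReal_mul (Real.rpow_nonneg hε.le _)]
            ring
        _ ≤ _ := by
            gcongr
    refine (iSup₂_le key).trans_lt (ENNReal.mul_lt_top ENNReal.ofReal_lt_top
      (ENNReal.mul_lt_top ENNReal.ofReal_lt_top ?_))
    exact (hC.isBounded.cthickening).measure_lt_top

/-- By density it suffices to treat indicators. Squeeze `s ∩ W` between a compact `K` and an open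
`U` with `U \ K` small; a thickened indicator of `K` supported in `U ∩ W` errs only on `U \ K`. -/
theorem exists_lipschitz_eLpNorm_sub_le {N : ℕ} {W : Set (E N)} (hW : IsOpen W) {f : E N → ℝ}
    (hf : MemLp f 1 (volume.restrict W)) {δ : ℝ≥0∞} (hδ : δ ≠ 0) :
    ∃ g : E N → ℝ, eLpNorm (f - g) 1 (volume.restrict W) ≤ δ ∧
      (∃ K : NNReal, LipschitzWith K g) ∧ ∀ x, x ∉ W → g x = 0 := by
  refine MemLp.induction_dense ENNReal.one_ne_top
    (fun g => (∃ K : NNReal, LipschitzWith K g) ∧ ∀ x, x ∉ W → g x = 0) ?_ ?_ ?_ hf hδ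
  · intro c s hs hμs ε hε
    obtain ⟨η, hη, hηε⟩ := exists_eLpNorm_indicator_le (μ := (volume : Measure (E N)))
      ENNReal.one_ne_top c hε
    rw [Measure.restrict_apply hs] at hμs
    have hη2 : (η : ℝ≥0∞) / 2 ≠ 0 := by simpa using hη.ne'
    have hsW := hs.inter hW.measurableSet
    obtain ⟨K, hK, hKc, hKlt⟩ := hsW.exists_isCompact_sdiff_lt hμs.ne hη2
    obtain ⟨U, hU, hUo, -, hUlt⟩ := hsW.exists_isOpen_sdiff_lt hμs.ne hη2
    obtain ⟨d, hd, hdU⟩ := hKc.exists_thickening_subset_open (hUo.inter hW)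
      (subset_inter (hK.trans hU) (hK.trans inter_subset_right))
    have hz : ∀ x, x ∉ U ∩ W → thickenedIndicator hd K x = 0 := fun x hx =>
      thickenedIndicator_zero hd K fun h => hx (hdU h)
    refine ⟨fun x => c * thickenedIndicator hd K x, ?_, ⟨‖c‖₊ * d.toNNReal⁻¹, ?_⟩, ?_⟩
    · refine le_trans ?_ (hηε (U \ K) ?_)
      · refine (eLpNorm_mono_ae ?_).trans (eLpNorm_mono_measure _ Measure.restrict_le_self)
        filter_upwards [ae_restrict_mem hW.measurableSet] with x hxW
        by_cases hxK : x ∈ K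
        · have : x ∈ s := (hK hxK).1
          rw [Pi.sub_apply, indicator_of_mem this, thickenedIndicator_one hd K hxK]
          simp
        by_cases hxU : x ∈ U
        · rw [indicator_of_mem (show x ∈ U \ K from ⟨hxU, hxK⟩)]
          have h1 : (thickenedIndicator hd K x : ℝ) ≤ 1 := thickenedIndicator_le_one hd K x
          have h2 : 0 ≤ (thickenedIndicator hd K x : ℝ) := NNReal.coe_nonneg _
          by_cases hxs : x ∈ s
          · rw [Pi.sub_apply, indicator_of_mem hxs, show c * (thickenedIndicator hd K x : ℝ) - c =
              c * (thickenedIndicator hd K x - 1) by ring, norm_mul]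
            refine mul_le_of_le_one_right (norm_nonneg _) ?_
            rw [Real.norm_eq_abs, abs_le]
            constructor <;> linarith
          · rw [Pi.sub_apply, indicator_of_notMem hxs, sub_zero, norm_mul]
            refine mul_le_of_le_one_right (norm_nonneg _) ?_
            rw [Real.norm_eq_abs, abs_le]
            constructor <;> linarith
        · have hxs : x ∉ s := fun h => hxU (hU ⟨h, hxW⟩)
          rw [Pi.sub_apply, indicator_of_notMem hxs, hz x fun h => hxU h.1]
          simp
      · calc volume (U \ K) ≤ volume (U \ (s ∩ W) ∪ (s ∩ W) \ K) := by
              refine measure_mono fun x hx => ?_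
              by_cases h : x ∈ s ∩ W
              exacts [Or.inr ⟨h, hx.2⟩, Or.inl ⟨hx.1, h⟩]
          _ ≤ η / 2 + η / 2 := (measure_union_le _ _).trans (add_le_add hUlt.le hKlt.le)
          _ = η := ENNReal.add_halves _
    · refine LipschitzWith.of_dist_le_mul fun x y => ?_
      have := (lipschitzWith_thickenedIndicator hd K).dist_le_mul x y
      rw [Real.dist_eq, ← mul_sub, abs_mul, NNReal.coe_mul, mul_assoc, coe_nnnorm,
        Real.norm_eq_abs]
      rw [NNReal.dist_eq] at this
      gcongr
    · intro x hx
      simp [hz x fun h => hx h.2]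
  · rintro f g ⟨⟨K, hK⟩, hf⟩ ⟨⟨K', hK'⟩, hg⟩
    exact ⟨⟨_, hK.add hK'⟩, fun x hx => by simp [hf x hx, hg x hx]⟩
  · rintro f ⟨⟨K, hK⟩, -⟩
    exact hK.continuous.aestronglyMeasurable

theorem exists_memV_eLpNorm_sub_le {N : ℕ} {C : Set (E N)} (hC : IsCompact C)
    (hCi : volume (C \ interior C) = 0) {α e : ℝ} (hα' : α ≤ 1) {f : E N → ℝ} (hf : Integrable f)
    (hf0 : ∀ᵐ x, x ∉ C → f x = 0) {δ : ℝ≥0∞} (hδ : δ ≠ 0) :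
    ∃ g, Measurable g ∧ MemV C α e g ∧ eLpNorm (f - g) 1 volume ≤ δ := by
  obtain ⟨g, hg, ⟨K, hK⟩, hg0⟩ := exists_lipschitz_eLpNorm_sub_le isOpen_interior
    (memLp_one_iff_integrable.2 hf.restrict) hδ
  refine ⟨g, hK.continuous.measurable,
    memV_of_lipschitz hC hα' hK fun x hx => hg0 x fun h => hx (interior_subset h), ?_⟩
  have : f - g =ᵐ[volume] (interior C).indicator (f - g) := by
    have h1 : ∀ᵐ x, x ∉ C \ interior C := measure_eq_zero_iff_ae_notMem.1 hCi
    filter_upwards [h1, hf0] with x h1 h2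
    by_cases hx : x ∈ interior C
    · rw [indicator_of_mem hx]
    · rw [indicator_of_notMem hx, Pi.sub_apply, hg0 x hx, h2 fun h => h1 ⟨h, hx⟩, sub_zero]
  rwa [eLpNorm_congr_ae this, eLpNorm_indicator_eq_eLpNorm_restrict isOpen_interior.measurableSet]

/-- A sequence in `V_α` that is dense in `L¹(C)`. -/
theorem exists_dense_seq_memV {N : ℕ} {C : Set (E N)} (hC : IsCompact C)
    (hCi : volume (C \ interior C) = 0) {α : ℝ} (e : ℝ) (hα' : α ≤ 1) :
    ∃ φ : ℕ → E N → ℝ, (∀ k, Measurable (φ k)) ∧ (∀ k, MemV C α e (φ k)) ∧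
      ∀ f, Integrable f → (∀ᵐ x, x ∉ C → f x = 0) → ∀ δ : ℝ≥0∞, 0 < δ →
        ∃ k, eLpNorm (f - φ k) 1 volume < δ := by
  -- The dense sequence is taken in this subset of the separable space `L¹`, so that its members
  -- themselves lie in `V_α`.
  let A : Set (Lp ℝ 1 (volume : Measure (E N))) :=
    {u | ∃ g, Measurable g ∧ MemV C α e g ∧ g =ᵐ[volume] u}
  have hA : ∀ g, Measurable g → ∀ hg : MemV C α e g,
      (memLp_one_iff_integrable.2 hg.integrable).toLp g ∈ A := fun g hm hg =>
    ⟨g, hm, hg, (MemLp.coeFn_toLp _).symm⟩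
  have hne : Nonempty A :=
    ⟨_, hA 0 measurable_zero (memV_of_lipschitz hC hα' (LipschitzWith.const (0 : ℝ)) (by simp))⟩
  have : Fact ((1 : ℝ≥0∞) ≠ ∞) := ⟨ENNReal.one_ne_top⟩
  choose φ hφm hφ hφu using fun k => (TopologicalSpace.denseSeq A k).2
  refine ⟨φ, hφm, hφ, fun f hf hf0 δ hδ => ?_⟩
  obtain ⟨g, hgm, hg, hfg⟩ := exists_memV_eLpNorm_sub_le (e := e) hC hCi hα' hf hf0
    (ENNReal.half_pos hδ.ne').ne'
  rcases eq_or_ne δ ∞ with rfl | hδt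
  · exact ⟨0, (memLp_one_iff_integrable.2 (hf.sub (hφ 0).integrable)).2⟩
  obtain ⟨k, hk⟩ := (TopologicalSpace.denseRange_denseSeq A).exists_dist_lt
    ⟨_, hA g hgm hg⟩ (ENNReal.toReal_pos (ENNReal.half_pos hδ.ne').ne'
      (ENNReal.div_ne_top hδt two_ne_zero))
  refine ⟨k, ?_⟩
  have h1 : eLpNorm (g - φ k) 1 volume < δ / 2 := by
    rw [Subtype.dist_eq, ← ENNReal.ofReal_lt_iff_lt_toReal dist_nonneg
      (ENNReal.div_ne_top hδt two_ne_zero), ← edist_dist, Lp.edist_def] at hk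
    rwa [eLpNorm_congr_ae
      ((memLp_one_iff_integrable.2 hg.integrable).coeFn_toLp.symm.sub (hφu k))]
  calc eLpNorm (f - φ k) 1 volume = eLpNorm ((f - g) + (g - φ k)) 1 volume := by
        rw [sub_add_sub_cancel]
    _ ≤ eLpNorm (f - g) 1 volume + eLpNorm (g - φ k) 1 volume :=
        eLpNorm_add_le (hf.sub hg.integrable).aestronglyMeasurable
          (hg.integrable.sub (hφ k).integrable).aestronglyMeasurable le_rfl
    _ < δ / 2 + δ / 2 := ENNReal.add_lt_add_of_le_of_lt
        (ne_top_of_le_ne_top (ENNReal.div_ne_top hδt two_ne_zero) hfg) hfg h1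
    _ = δ := ENNReal.add_halves _


/-! ### The transfer operator of a single fibre -/

namespace BranchedFamily

variable {Ω ι : Type*} {N : ℕ} {C : Set (E N)}

/-- The properties of a single fibre map that make its transfer operator the dual of composition
with the map. -/
structure RegularFiber (Φ : BranchedFamily Ω ι C) (ω : Ω) : Prop where
  isOpen_U : ∀ i, IsOpen (Φ.U ω i)
  isOpen_V : ∀ i, IsOpen (Φ.V ω i)
  U_subset : ∀ i, Φ.U ω i ⊆ C
  disjoint_U : ∀ i j, i ≠ j → Disjoint (Φ.U ω i) (Φ.U ω j)
  U_subset_V : ∀ i, Φ.U ω i ⊆ Φ.V ω i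
  branch_eq : ∀ i, ∀ x : C, (x : E N) ∈ Φ.U ω i → (Φ.T ω x : E N) = Φ.branch ω i x
  contDiffOn_branch : ∀ i, ContDiffOn ℝ 1 (Φ.branch ω i) (Φ.V ω i)
  injOn_branch : ∀ i, InjOn (Φ.branch ω i) (Φ.V ω i)
  contDiffOn_inv : ∀ i, ContDiffOn ℝ 1 (Φ.inv ω i) (Φ.branch ω i '' Φ.V ω i)
  covers : volume (C \ ⋃ i, Φ.U ω i) = 0

theorem _root_.Saussol.BranchedFamily.IsRandomSaussol.ae_regularFiber [TopologicalSpace Ω]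
    [MeasurableSpace Ω] {Φ : BranchedFamily Ω ι C} {P : Measure Ω} {α ε₀ e : ℝ} {s : Ω → ℝ}
    {S c : ℝ} (h : Φ.IsRandomSaussol P α ε₀ e s S c) : ∀ᵐ ω ∂P, Φ.RegularFiber ω := by
  filter_upwards [h.branch_eq, h.contDiffOn_branch, h.injOn_branch, h.contDiffOn_inv, h.covers]
    with ω h1 h2 h3 h4 h5
  exact ⟨h.isOpen_U ω, h.isOpen_V ω, h.U_subset ω, h.disjoint_U ω,
    fun i => subset_closure.trans (h.closure_U ω i), h1, h2, h3, h4, h5⟩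

/-- The contribution of one branch to the transfer operator. -/
noncomputable def branchTransfer (Φ : BranchedFamily Ω ι C) (ω : Ω) (i : ι) (f : E N → ℝ) :
    E N → ℝ :=
  (Φ.branch ω i '' Φ.U ω i).indicator
    (fun x => |(fderiv ℝ (Φ.branch ω i) (Φ.inv ω i x)).det|⁻¹ * f (Φ.inv ω i x))

namespace RegularFiber

variable {Φ : BranchedFamily Ω ι C} {ω : Ω}

theorem inv_branch (h : Φ.RegularFiber ω) (i : ι) {y : E N} (hy : y ∈ Φ.V ω i) :
    Φ.inv ω i (Φ.branch ω i y) = y :=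
  (h.injOn_branch i).leftInvOn_invFunOn hy

theorem hasFDerivAt_branch (h : Φ.RegularFiber ω) (i : ι) {y : E N} (hy : y ∈ Φ.V ω i) :
    HasFDerivAt (Φ.branch ω i) (fderiv ℝ (Φ.branch ω i) y) y :=
  (((h.contDiffOn_branch i).differentiableOn one_ne_zero).differentiableAt
    ((h.isOpen_V i).mem_nhds hy)).hasFDerivAt

/-- The chain rule for the differentiable inverse makes the two determinants multiply to 1. -/
theorem det_fderiv_ne_zero (h : Φ.RegularFiber ω) (i : ι) {y : E N} (hy : y ∈ Φ.V ω i) :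
    (fderiv ℝ (Φ.branch ω i) y).det ≠ 0 := by
  have h1 := (((h.contDiffOn_inv i).differentiableOn one_ne_zero) _
    (mem_image_of_mem _ hy)).hasFDerivWithinAt
  have h2 := h1.comp y (h.hasFDerivAt_branch i hy).hasFDerivWithinAt (mapsTo_image _ (Φ.V ω i))
  have h3 : HasFDerivWithinAt (Φ.inv ω i ∘ Φ.branch ω i) (ContinuousLinearMap.id ℝ (E N))
      (Φ.V ω i) y :=
    (hasFDerivWithinAt_id y _).congr (fun z hz => h.inv_branch i hz) (h.inv_branch i hy)
  have h4 := ((h.isOpen_V i).uniqueDiffWithinAt hy).eq h2 h3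
  have h5 := congrArg ContinuousLinearMap.det h4
  intro h0
  simp only [ContinuousLinearMap.det, ContinuousLinearMap.toLinearMap_comp, LinearMap.det_comp,
    ContinuousLinearMap.coe_id, LinearMap.det_id] at h5 h0
  rw [h0, mul_zero] at h5
  exact zero_ne_one h5

theorem branchTransfer_branch (h : Φ.RegularFiber ω) (i : ι) (f : E N → ℝ) {y : E N}
    (hy : y ∈ Φ.U ω i) : Φ.branchTransfer ω i f (Φ.branch ω i y) =
      |(fderiv ℝ (Φ.branch ω i) y).det|⁻¹ * f y := by
  rw [branchTransfer, indicator_of_mem (mem_image_of_mem _ hy),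
    h.inv_branch i (h.U_subset_V i hy)]

theorem measurableSet_image_U (h : Φ.RegularFiber ω) (i : ι) :
    MeasurableSet (Φ.branch ω i '' Φ.U ω i) :=
  measurable_image_of_fderivWithin (h.isOpen_U i).measurableSet
    (fun _ hy => (h.hasFDerivAt_branch i (h.U_subset_V i hy)).hasFDerivWithinAt)
    ((h.injOn_branch i).mono (h.U_subset_V i))

/-- Change of variables along a branch. -/
theorem lintegral_branch (h : Φ.RegularFiber ω) (i : ι) {G F : E N → ℝ≥0∞}
    (h0 : ∀ x, x ∉ Φ.branch ω i '' Φ.U ω i → G x = 0)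
    (hG : ∀ y ∈ Φ.U ω i, G (Φ.branch ω i y) =
      ENNReal.ofReal (|(fderiv ℝ (Φ.branch ω i) y).det|⁻¹) * F y) :
    ∫⁻ x, G x = ∫⁻ y in Φ.U ω i, F y := by
  have h1 : G = (Φ.branch ω i '' Φ.U ω i).indicator G := by
    ext x
    by_cases hx : x ∈ Φ.branch ω i '' Φ.U ω i
    · rw [indicator_of_mem hx]
    · rw [indicator_of_notMem hx, h0 x hx]
  rw [h1, lintegral_indicator (h.measurableSet_image_U i),
    lintegral_image_eq_lintegral_abs_det_fderiv_mul _ (h.isOpen_U i).measurableSet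
      (fun y hy => (h.hasFDerivAt_branch i (h.U_subset_V i hy)).hasFDerivWithinAt)
      ((h.injOn_branch i).mono (h.U_subset_V i))]
  refine setLIntegral_congr_fun (h.isOpen_U i).measurableSet fun y hy => ?_
  have hd := abs_pos.2 (h.det_fderiv_ne_zero i (h.U_subset_V i hy))
  rw [hG y hy, ← mul_assoc, ← ENNReal.ofReal_mul hd.le, mul_inv_cancel₀ hd.ne',
    ENNReal.ofReal_one, one_mul]

theorem lintegral_enorm_branchTransfer (h : Φ.RegularFiber ω) (i : ι) (f : E N → ℝ) :
    ∫⁻ x, ‖Φ.branchTransfer ω i f x‖ₑ = ∫⁻ y in Φ.U ω i, ‖f y‖ₑ := by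
  refine h.lintegral_branch i (fun x hx => ?_) fun y hy => ?_
  · rw [branchTransfer, indicator_of_notMem hx, enorm_zero]
  · rw [h.branchTransfer_branch i f hy, enorm_mul, Real.enorm_of_nonneg (by positivity)]

/-- Differentiable maps send null sets to null sets, so the operator respects almost-everywhere
classes. -/
theorem branchTransfer_congr_ae (h : Φ.RegularFiber ω) (i : ι) {f g : E N → ℝ}
    (hfg : f =ᵐ[volume] g) : Φ.branchTransfer ω i f =ᵐ[volume] Φ.branchTransfer ω i g := by
  have h0 : volume (Φ.branch ω i '' ({x | ¬ f x = g x} ∩ Φ.U ω i)) = 0 := by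
    refine addHaar_image_eq_zero_of_differentiableOn_of_addHaar_eq_zero _ (fun y hy => ?_)
      (measure_mono_null inter_subset_left hfg)
    exact (h.hasFDerivAt_branch i
      (h.U_subset_V i hy.2)).differentiableAt.differentiableWithinAt
  filter_upwards [measure_eq_zero_iff_ae_notMem.1 h0] with x hx
  by_cases hxU : x ∈ Φ.branch ω i '' Φ.U ω i
  · obtain ⟨y, hy, rfl⟩ := hxU
    rw [h.branchTransfer_branch i f hy, h.branchTransfer_branch i g hy]
    congr 1
    by_contra hne
    exact hx (mem_image_of_mem _ ⟨hne, hy⟩)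
  · rw [branchTransfer, branchTransfer, indicator_of_notMem hxU, indicator_of_notMem hxU]

theorem aestronglyMeasurable_branchTransfer (h : Φ.RegularFiber ω) (i : ι) {f : E N → ℝ}
    (hf : AEStronglyMeasurable f volume) :
    AEStronglyMeasurable (Φ.branchTransfer ω i f) volume := by
  refine AEStronglyMeasurable.congr (AEMeasurable.aestronglyMeasurable ?_)
    (h.branchTransfer_congr_ae i hf.ae_eq_mk.symm)
  have hsub := image_mono (f := Φ.branch ω i) (h.U_subset_V i)
  rw [branchTransfer, aemeasurable_indicator_iff (h.measurableSet_image_U i)]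
  have hinv : ContinuousOn (Φ.inv ω i) (Φ.branch ω i '' Φ.U ω i) :=
    (h.contDiffOn_inv i).continuousOn.mono hsub
  have hmaps : MapsTo (Φ.inv ω i) (Φ.branch ω i '' Φ.U ω i) (Φ.V ω i) := by
    rintro _ ⟨y, hy, rfl⟩
    rw [h.inv_branch i (h.U_subset_V i hy)]
    exact h.U_subset_V i hy
  have hdet : ContinuousOn
      (fun x => |(fderiv ℝ (Φ.branch ω i) (Φ.inv ω i x)).det|⁻¹) (Φ.branch ω i '' Φ.U ω i) := by
    have h1 : ContinuousOn (fun x => fderiv ℝ (Φ.branch ω i) (Φ.inv ω i x))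
        (Φ.branch ω i '' Φ.U ω i) :=
      ((h.contDiffOn_branch i).continuousOn_fderiv_of_isOpen (h.isOpen_V i) le_rfl).comp hinv hmaps
    refine ContinuousOn.inv₀
      (ContinuousLinearMap.continuous_det.comp_continuousOn h1).abs fun x hx => ?_
    exact abs_ne_zero.2 (h.det_fderiv_ne_zero i (hmaps hx))
  exact (hdet.aemeasurable (h.measurableSet_image_U i)).mul
    (hf.stronglyMeasurable_mk.measurable.comp_aemeasurable
      (hinv.aemeasurable (h.measurableSet_image_U i)))

theorem tsum_setLIntegral [Countable ι] (h : Φ.RegularFiber ω) (F : E N → ℝ≥0∞) :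
    ∑' i, ∫⁻ y in Φ.U ω i, F y = ∫⁻ y in C, F y := by
  rw [← lintegral_iUnion (fun i => (h.isOpen_U i).measurableSet)
    (fun i j hij => h.disjoint_U i j hij)]
  refine setLIntegral_congr ?_
  refine (ae_le_set.2 ?_).antisymm (ae_le_set.2 h.covers)
  rw [sdiff_eq_empty.2 (iUnion_subset h.U_subset), measure_empty]

theorem lintegral_tsum_enorm_branchTransfer [Countable ι] (h : Φ.RegularFiber ω) {f : E N → ℝ}
    (hf : AEStronglyMeasurable f volume) :
    ∫⁻ x, ∑' i, ‖Φ.branchTransfer ω i f x‖ₑ = ∫⁻ y in C, ‖f y‖ₑ := by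
  rw [lintegral_tsum fun i => (h.aestronglyMeasurable_branchTransfer i hf).enorm]
  simp_rw [h.lintegral_enorm_branchTransfer]
  exact h.tsum_setLIntegral _

/-- A divergent `tsum` has the value 0, so linearity and duality of `transfer` rest on this. The
series of absolute values has finite integral. -/
theorem ae_summable [Countable ι] (h : Φ.RegularFiber ω) {f : E N → ℝ} (hf : Integrable f) :
    ∀ᵐ x, Summable fun i => Φ.branchTransfer ω i f x := by
  have h1 := ae_lt_top' (μ := volume) (f := fun x => ∑' i, ‖Φ.branchTransfer ω i f x‖ₑ)
    (AEMeasurable.tsum fun i => (h.aestronglyMeasurable_branchTransfer i hf.1).enorm) (by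
      rw [h.lintegral_tsum_enorm_branchTransfer hf.1]
      exact hf.restrict.2.ne)
  filter_upwards [h1] with x hx
  refine Summable.of_norm ?_
  have := ENNReal.tsum_coe_ne_top_iff_summable.1 hx.ne
  exact NNReal.summable_coe.2 this

theorem aestronglyMeasurable_transfer [Countable ι] (h : Φ.RegularFiber ω) {f : E N → ℝ}
    (hf : Integrable f) : AEStronglyMeasurable (Φ.transfer ω f) volume := by
  refine aestronglyMeasurable_of_tendsto_ae Filter.atTop
    (f := fun (s : Finset ι) x => ∑ i ∈ s, Φ.branchTransfer ω i f x)
    (fun s => Finset.aestronglyMeasurable_fun_sum s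
      fun i _ => h.aestronglyMeasurable_branchTransfer i hf.1) ?_
  filter_upwards [h.ae_summable hf] with x hx using hx.hasSum

theorem eLpNorm_transfer_le [Countable ι] (h : Φ.RegularFiber ω) {f : E N → ℝ}
    (hf : Integrable f) : eLpNorm (Φ.transfer ω f) 1 volume ≤ eLpNorm f 1 volume := by
  rw [eLpNorm_one_eq_lintegral_enorm, eLpNorm_one_eq_lintegral_enorm]
  calc ∫⁻ x, ‖Φ.transfer ω f x‖ₑ ≤ ∫⁻ x, ∑' i, ‖Φ.branchTransfer ω i f x‖ₑ :=
        lintegral_mono fun x => enorm_tsum_le_tsum_enorm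
    _ = ∫⁻ y in C, ‖f y‖ₑ := h.lintegral_tsum_enorm_branchTransfer hf.1
    _ ≤ _ := setLIntegral_le_lintegral _ _

theorem integrable_transfer [Countable ι] (h : Φ.RegularFiber ω) {f : E N → ℝ}
    (hf : Integrable f) : Integrable (Φ.transfer ω f) :=
  memLp_one_iff_integrable.1 ⟨h.aestronglyMeasurable_transfer hf,
    (h.eLpNorm_transfer_le hf).trans_lt (memLp_one_iff_integrable.2 hf).2⟩

theorem transfer_sub [Countable ι] (h : Φ.RegularFiber ω) {f g : E N → ℝ}
    (hf : Integrable f) (hg : Integrable g) :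
    Φ.transfer ω (f - g) =ᵐ[volume] Φ.transfer ω f - Φ.transfer ω g := by
  filter_upwards [h.ae_summable hf, h.ae_summable hg] with x h1 h2
  change ∑' i, Φ.branchTransfer ω i (f - g) x = _
  have h3 : ∀ i, Φ.branchTransfer ω i (f - g) x =
      Φ.branchTransfer ω i f x - Φ.branchTransfer ω i g x := fun i => by
    by_cases hx : x ∈ Φ.branch ω i '' Φ.U ω i
    · simp only [branchTransfer, indicator_of_mem hx, Pi.sub_apply]
      ring
    · simp only [branchTransfer, indicator_of_notMem hx, sub_zero]
  simp_rw [h3]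
  exact h1.tsum_sub h2

theorem transfer_eq_zero (h : Φ.RegularFiber ω) (f : E N → ℝ) {x : E N} (hx : x ∉ C) :
    Φ.transfer ω f x = 0 := by
  have : ∀ i, Φ.branchTransfer ω i f x = 0 := fun i => by
    refine indicator_of_notMem ?_ _
    rintro ⟨y, hy, rfl⟩
    rw [← h.branch_eq i ⟨y, h.U_subset i hy⟩ hy] at hx
    exact hx (Subtype.coe_prop _)
  change ∑' i, Φ.branchTransfer ω i f x = 0
  simp [this]

/-- Duality with composition: change variables on each branch, then sum over the pieces, which
exhaust `C` up to a null set. -/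
theorem setLIntegral_transfer [Countable ι] (h : Φ.RegularFiber ω) {f : E N → ℝ}
    (hf : Integrable f) (hf0 : ∀ x, 0 ≤ f x) {B : Set (E N)} (hB : MeasurableSet B)
    (hT : Measurable (Φ.T ω)) (hC : MeasurableSet C) :
    ∫⁻ x in B, ENNReal.ofReal (Φ.transfer ω f x) =
      ∫⁻ x in Subtype.val '' (Φ.T ω ⁻¹' (Subtype.val ⁻¹' B)), ENNReal.ofReal (f x) := by
  have hnn : ∀ i x, 0 ≤ Φ.branchTransfer ω i f x := fun i x =>
    indicator_nonneg (fun x _ => mul_nonneg (by positivity) (hf0 _)) x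
  set D : Set (E N) := Subtype.val '' (Φ.T ω ⁻¹' (Subtype.val ⁻¹' B)) with hD
  have hDm : MeasurableSet D := hC.subtype_image (hT (measurable_subtype_coe hB))
  have hDC : D ⊆ C := by
    rintro _ ⟨y, -, rfl⟩
    exact y.2
  have h1 : ∫⁻ x in B, ENNReal.ofReal (Φ.transfer ω f x) =
      ∫⁻ x, ∑' i, B.indicator (fun x => ENNReal.ofReal (Φ.branchTransfer ω i f x)) x := by
    rw [← lintegral_indicator hB]
    refine lintegral_congr_ae ?_
    filter_upwards [h.ae_summable hf] with x hx
    by_cases hxB : x ∈ B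
    · simp only [indicator_of_mem hxB]
      exact ENNReal.ofReal_tsum_of_nonneg (fun i => hnn i x) hx
    · simp [indicator_of_notMem hxB]
  rw [h1, lintegral_tsum fun i => ((h.aestronglyMeasurable_branchTransfer i
    hf.1).aemeasurable.ennreal_ofReal).indicator hB]
  have h2 : ∀ i, ∫⁻ x, B.indicator (fun x => ENNReal.ofReal (Φ.branchTransfer ω i f x)) x =
      ∫⁻ y in Φ.U ω i, D.indicator (fun y => ENNReal.ofReal (f y)) y := fun i => by
    refine h.lintegral_branch i (fun x hx => ?_) fun y hy => ?_
    · simp [branchTransfer, indicator_of_notMem hx]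
    · have hiff : Φ.branch ω i y ∈ B ↔ y ∈ D := by
        rw [← h.branch_eq i ⟨y, h.U_subset i hy⟩ hy]
        simp [hD, h.U_subset i hy]
      by_cases hyD : y ∈ D
      · rw [indicator_of_mem hyD, indicator_of_mem (hiff.2 hyD), h.branchTransfer_branch i f hy,
          ENNReal.ofReal_mul (by positivity)]
      · rw [indicator_of_notMem hyD, indicator_of_notMem (mt hiff.1 hyD), mul_zero]
  simp_rw [h2]
  rw [h.tsum_setLIntegral, ← lintegral_indicator hC, indicator_indicator,
    inter_eq_self_of_subset_right hDC, lintegral_indicator hDm]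

end RegularFiber

end BranchedFamily

end Saussol

/-! ### Countable generation and singularity of ergodic measures -/

/-- Countability allows one exceptional null set of `ω` to serve all test sets; `univ` supplies
equality of total masses. -/
theorem MeasureTheory.exists_countable_piSystem (X : Type*) [m : MeasurableSpace X]
    [MeasurableSpace.CountablyGenerated X] :
    ∃ 𝒜 : Set (Set X), 𝒜.Countable ∧ IsPiSystem 𝒜 ∧ m = MeasurableSpace.generateFrom 𝒜 ∧
      univ ∈ 𝒜 := by
  refine ⟨generateSetAlgebra (MeasurableSpace.countableGeneratingSet X),
    countable_generateSetAlgebra MeasurableSpace.countable_countableGeneratingSet,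
    fun s hs t ht _ => isSetAlgebra_generateSetAlgebra.inter_mem hs ht, ?_,
    isSetAlgebra_generateSetAlgebra.univ_mem⟩
  rw [generateFrom_generateSetAlgebra_eq, MeasurableSpace.generateFrom_countableGeneratingSet]

/-- Distinct ergodic probability measures of the same map are mutually singular. -/
theorem Ergodic.mutuallySingular_of_ne {X : Type*} [MeasurableSpace X] {f : X → X}
    {μ ν : Measure X} [IsProbabilityMeasure μ] [IsProbabilityMeasure ν] (hμ : Ergodic f μ)
    (hν : Ergodic f ν) (hne : μ ≠ ν) : μ ⟂ₘ ν := by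
  -- The `ν`-absolutely continuous part `ρ` of `μ` is invariant and absolutely continuous with
  -- respect to both measures, so ergodicity gives `ρ = c ν = c' μ`. Total masses give `c = c'`;
  -- then `c = 0` means singularity and `c ≠ 0` forces `μ = ν`.
  set ρ := ν.withDensity (μ.rnDeriv ν) with hρ
  have hρf : MeasurePreserving f ρ ρ :=
    hμ.toMeasurePreserving.withDensity_rnDeriv hν.toMeasurePreserving
  have hρμ : ρ ≤ μ := Measure.withDensity_rnDeriv_le μ ν
  have : IsFiniteMeasure ρ := isFiniteMeasure_of_le μ hρμ
  obtain ⟨c, hc⟩ := hν.eq_smul_of_absolutelyContinuous hρf (withDensity_absolutelyContinuous _ _)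
  obtain ⟨c', hc'⟩ := hμ.eq_smul_of_absolutelyContinuous hρf hρμ.absolutelyContinuous
  have h1 : ρ univ = c := by simp [hc]
  have h2 : ρ univ = c' := by simp [hc']
  have hcc : c = c' := h1.symm.trans h2
  rcases eq_or_ne c 0 with h0 | h0
  · rw [← Measure.rnDeriv_eq_zero]
    have : ν.withDensity (μ.rnDeriv ν) = 0 := by rw [← hρ, hc, h0, zero_smul]
    rwa [withDensity_eq_zero_iff (Measure.measurable_rnDeriv _ _).aemeasurable] at this
  · refine absurd ?_ hne
    have hct : c ≠ ∞ := h1 ▸ measure_ne_top ρ univ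
    ext s -
    have h3 : c * ν s = c * μ s := by
      have := congrArg (fun m : Measure X => m s) (hc.symm.trans hc')
      simpa [← hcc] using this
    exact ((ENNReal.mul_right_inj h0 hct).1 h3).symm

/-! ### Fibre densities of invariant measures -/

namespace Saussol

namespace BranchedFamily

variable {Ω ι : Type*} {N : ℕ} {C : Set (E N)}

/-- `H` is a version of the density of the measure `μ` on `Ω × C` with respect to `P × m`. -/
structure IsDensity [MeasurableSpace Ω] (P : Measure Ω) (μ : Measure (Ω × C))
    (H : Ω → E N → ℝ) : Prop where
  measurable : Measurable fun p : Ω × E N => H p.1 p.2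
  nonneg : ∀ ω x, 0 ≤ H ω x
  eq_zero : ∀ ω x, x ∉ C → H ω x = 0
  map_eq : μ.map (Prod.map id Subtype.val) =
    (P.prod volume).withDensity fun p => ENNReal.ofReal (H p.1 p.2)

theorem exists_isDensity [MeasurableSpace Ω] {P : Measure Ω} [IsProbabilityMeasure P]
    (hC : IsCompact C) {μ : Measure (Ω × C)} [IsProbabilityMeasure μ]
    (hμ : μ ≪ P.prod ((volume : Measure (E N)).comap (fun x : C => (x : E N)))) :
    ∃ H, IsDensity P μ H := by
  have hemb : MeasurableEmbedding (Subtype.val : C → E N) :=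
    MeasurableEmbedding.subtype_coe hC.measurableSet
  have hm : Measurable (Prod.map id Subtype.val : Ω × C → Ω × E N) :=
    measurable_id.prodMap measurable_subtype_coe
  have : IsFiniteMeasure ((volume : Measure (E N)).comap (fun x : C => (x : E N))) := by
    refine ⟨?_⟩
    rw [hemb.comap_apply]
    exact (measure_mono (image_subset_iff.2 fun x _ => x.2)).trans_lt hC.measure_lt_top
  set ν := μ.map (Prod.map id Subtype.val) with hν
  have : IsProbabilityMeasure ν := Measure.isProbabilityMeasure_map hm.aemeasurable
  have hac : ν ≪ P.prod volume := by
    refine (hμ.map hm).trans ?_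
    rw [← Measure.map_prod_map _ _ measurable_id measurable_subtype_coe, Measure.map_id,
      hemb.map_comap]
    exact Measure.AbsolutelyContinuous.rfl.prod Measure.restrict_le_self.absolutelyContinuous
  have hwd := Measure.withDensity_rnDeriv_eq _ _ hac
  set R := ν.rnDeriv (P.prod volume)
  have hR : Measurable R := Measure.measurable_rnDeriv _ _
  -- Truncating to `C` and passing to real values makes the pointwise properties hold everywhere.
  -- Nothing is lost, as `ν` does not charge the complement of `C`.
  refine ⟨fun ω => C.indicator fun x => (R (ω, x)).toReal, ?_, ?_, ?_, ?_⟩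
  · have : (fun p : Ω × E N => C.indicator (fun x => (R (p.1, x)).toReal) p.2) =
        (Prod.snd ⁻¹' C).indicator fun p => (R p).toReal := rfl
    rw [this]
    exact hR.ennreal_toReal.indicator (measurable_snd hC.measurableSet)
  · exact fun ω x => indicator_nonneg (fun _ _ => ENNReal.toReal_nonneg) _
  · exact fun ω x hx => indicator_of_notMem hx _
  · rw [← hν, ← hwd]
    refine withDensity_congr_ae ?_
    have h0 : ∫⁻ p in (Prod.snd ⁻¹' C)ᶜ, R p ∂(P.prod volume) = 0 := by
      rw [← withDensity_apply _ (measurable_snd hC.measurableSet).compl, hwd, hν,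
        Measure.map_apply hm (measurable_snd hC.measurableSet).compl]
      convert measure_empty (μ := μ)
      ext ⟨ω, x⟩
      simp
    rw [lintegral_eq_zero_iff hR, Filter.EventuallyEq,
      ae_restrict_iff' (measurable_snd hC.measurableSet).compl] at h0
    filter_upwards [h0, Measure.rnDeriv_lt_top ν (P.prod volume)] with p h1 h2
    by_cases hp : p.2 ∈ C
    · rw [indicator_of_mem hp, ENNReal.ofReal_toReal h2.ne]
    · rw [indicator_of_notMem hp, ENNReal.ofReal_zero]
      exact h1 hp

namespace IsDensity

variable [MeasurableSpace Ω] {P : Measure Ω} {μ : Measure (Ω × C)} {H : Ω → E N → ℝ}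

theorem measurable_ofReal (h : IsDensity P μ H) :
    Measurable fun p : Ω × E N => ENNReal.ofReal (H p.1 p.2) :=
  h.measurable.ennreal_ofReal

theorem measurable_fiber (h : IsDensity P μ H) (ω : Ω) : Measurable (H ω) :=
  h.measurable.comp measurable_prodMk_left

theorem lintegral_lintegral_indicator (h : IsDensity P μ H) {A : Set (Ω × E N)}
    (hA : MeasurableSet A) :
    ∫⁻ ω, ∫⁻ x, A.indicator (fun p => ENNReal.ofReal (H p.1 p.2)) (ω, x) ∂volume ∂P =
      μ (Prod.map id Subtype.val ⁻¹' A) := by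
  rw [← lintegral_prod _ (h.measurable_ofReal.indicator hA).aemeasurable, lintegral_indicator hA,
    ← withDensity_apply _ hA, ← h.map_eq,
    Measure.map_apply (measurable_id.prodMap measurable_subtype_coe) hA]

theorem measurable_setLIntegral (h : IsDensity P μ H) (B : Set (E N)) :
    Measurable fun ω => ∫⁻ x in B, ENNReal.ofReal (H ω x) :=
  h.measurable_ofReal.lintegral_prod_right'

theorem ae_ae_eq_zero_or_eq_zero (h : IsDensity P μ H) (hC : IsCompact C) {μ' : Measure (Ω × C)}
    {H' : Ω → E N → ℝ} (h' : IsDensity P μ' H') (hs : μ ⟂ₘ μ') :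
    ∀ᵐ ω ∂P, ∀ᵐ x, H ω x = 0 ∨ H' ω x = 0 := by
  obtain ⟨s, hs, hs1, hs2⟩ := hs
  have hemb : MeasurableEmbedding (Prod.map id Subtype.val : Ω × C → Ω × E N) :=
    (MeasurableEmbedding.id).prodMap (MeasurableEmbedding.subtype_coe hC.measurableSet)
  set D := Prod.map id Subtype.val '' s
  have hD : MeasurableSet D := hemb.measurableSet_image.2 hs
  have hpre : Prod.map id Subtype.val ⁻¹' D = s := preimage_image_eq _ hemb.injective
  have h1 : ∫⁻ p in D, ENNReal.ofReal (H p.1 p.2) ∂(P.prod volume) = 0 := by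
    rw [← withDensity_apply _ hD, ← h.map_eq, hemb.map_apply, hpre, hs1]
  have h2 : ∫⁻ p in Dᶜ, ENNReal.ofReal (H' p.1 p.2) ∂(P.prod volume) = 0 := by
    rw [← withDensity_apply _ hD.compl, ← h'.map_eq, hemb.map_apply, preimage_compl, hpre, hs2]
  rw [lintegral_eq_zero_iff h.measurable_ofReal, Filter.EventuallyEq, ae_restrict_iff' hD] at h1
  rw [lintegral_eq_zero_iff h'.measurable_ofReal, Filter.EventuallyEq,
    ae_restrict_iff' hD.compl] at h2
  refine Measure.ae_ae_of_ae_prod (p := fun p : Ω × E N => H p.1 p.2 = 0 ∨ H' p.1 p.2 = 0) ?_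
  filter_upwards [h1, h2] with p hp hp'
  by_cases hpD : p ∈ D
  · exact Or.inl (le_antisymm (ENNReal.ofReal_eq_zero.1 (hp hpD)) (h.nonneg _ _))
  · exact Or.inr (le_antisymm (ENNReal.ofReal_eq_zero.1 (hp' hpD)) (h'.nonneg _ _))

variable [IsProbabilityMeasure P]

theorem setLIntegral_setLIntegral (h : IsDensity P μ H) {A : Set Ω} {B : Set (E N)}
    (hA : MeasurableSet A) (hB : MeasurableSet B) :
    ∫⁻ ω in A, ∫⁻ x in B, ENNReal.ofReal (H ω x) ∂volume ∂P =
      μ (A ×ˢ (Subtype.val ⁻¹' B)) := by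
  rw [← lintegral_prod (μ := P.restrict A) (ν := volume.restrict B) _
    h.measurable_ofReal.aemeasurable, Measure.prod_restrict, ← withDensity_apply _ (hA.prod hB),
    ← h.map_eq, Measure.map_apply (measurable_id.prodMap measurable_subtype_coe) (hA.prod hB)]
  rfl

/-- The fibre densities of an invariant measure have total mass one. -/
theorem ae_lintegral_eq_one (h : IsDensity P μ H) {Φ : BranchedFamily Ω ι C} {σ : Ω → Ω}
    (hσ : Ergodic σ P) [IsProbabilityMeasure μ]
    (hμ : MeasurePreserving (Φ.skewProduct σ) μ μ) :
    ∀ᵐ ω ∂P, ∫⁻ x, ENNReal.ofReal (H ω x) = 1 := by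
  have hA : ∀ A, MeasurableSet A →
      μ.map Prod.fst A = ∫⁻ ω in A, ∫⁻ x, ENNReal.ofReal (H ω x) ∂volume ∂P := fun A hA => by
    have := h.setLIntegral_setLIntegral hA MeasurableSet.univ
    rw [Measure.restrict_univ] at this
    rw [this, Measure.map_apply measurable_fst hA]
    congr 1
    ext p
    simp
  have : IsProbabilityMeasure (μ.map Prod.fst) :=
    Measure.isProbabilityMeasure_map measurable_fst.aemeasurable
  have hinv : MeasurePreserving σ (μ.map Prod.fst) (μ.map Prod.fst) := by
    refine ⟨hσ.measurable, ?_⟩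
    rw [Measure.map_map hσ.measurable measurable_fst]
    change μ.map (Prod.fst ∘ Φ.skewProduct σ) = _
    rw [← Measure.map_map measurable_fst hμ.measurable, hμ.map_eq]
  have hac : μ.map Prod.fst ≪ P := by
    refine Measure.AbsolutelyContinuous.mk fun A hAm hA0 => ?_
    rw [hA A hAm, Measure.restrict_eq_zero.2 hA0, lintegral_zero_measure]
  -- The density of the base marginal is the fibre mass; ergodicity of `σ` forces this marginal to
  -- be `P`.
  have heq := hσ.eq_of_absolutelyContinuous hinv hac
  have hmeas := h.measurable_setLIntegral univ
  simp only [Measure.restrict_univ] at hmeas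
  refine ae_eq_of_forall_setLIntegral_eq_of_sigmaFinite hmeas measurable_const
    fun A hAm _ => ?_
  rw [← hA A hAm, heq]
  simp

/-- The transfer operators map the fibre densities of an invariant measure to each other. -/
theorem ae_eq_transfer [Countable ι] (h : IsDensity P μ H) {Φ : BranchedFamily Ω ι C}
    {σ : Ω ≃ᵐ Ω} (hC : IsCompact C) (hσ : Ergodic σ P) [IsProbabilityMeasure μ]
    (hμ : MeasurePreserving (Φ.skewProduct σ) μ μ) (hΦ : ∀ᵐ ω ∂P, Φ.RegularFiber ω) :
    ∀ᵐ ω ∂P, H (σ ω) =ᵐ[volume] Φ.transfer ω (H ω) := by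
  have hT : ∀ ω, Measurable (Φ.T ω) := fun ω =>
    measurable_snd.comp (hμ.measurable.comp measurable_prodMk_left)
  have hemb : MeasurableEmbedding (Prod.map id Subtype.val : Ω × C → Ω × E N) :=
    (MeasurableEmbedding.id).prodMap (MeasurableEmbedding.subtype_coe hC.measurableSet)
  obtain ⟨𝒜, h𝒜c, h𝒜pi, h𝒜gen, h𝒜univ⟩ := exists_countable_piSystem (E N)
  have hmain : ∀ B ∈ 𝒜, ∀ᵐ ω ∂P, ∫⁻ x in B, ENNReal.ofReal (H (σ ω) x) =
      ∫⁻ x in Subtype.val '' (Φ.T ω ⁻¹' (Subtype.val ⁻¹' B)), ENNReal.ofReal (H ω x) := by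
    intro B hBA
    have hB : MeasurableSet B := by
      rw [h𝒜gen]
      exact MeasurableSpace.measurableSet_generateFrom hBA
    set D : Set (Ω × E N) := Prod.map id Subtype.val ''
      (Φ.skewProduct σ ⁻¹' (univ ×ˢ (Subtype.val ⁻¹' B))) with hD
    have hDm : MeasurableSet D := hemb.measurableSet_image.2
      (hμ.measurable (MeasurableSet.univ.prod (measurable_subtype_coe hB)))
    have hsec : ∀ ω x, (ω, x) ∈ D ↔ x ∈ Subtype.val '' (Φ.T ω ⁻¹' (Subtype.val ⁻¹' B)) := by
      intro ω x
      simp [hD, skewProduct]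
    have hfib : ∀ ω, ∫⁻ x in Subtype.val '' (Φ.T ω ⁻¹' (Subtype.val ⁻¹' B)),
        ENNReal.ofReal (H ω x) =
        ∫⁻ x, D.indicator (fun p => ENNReal.ofReal (H p.1 p.2)) (ω, x) := fun ω => by
      rw [← lintegral_indicator (hC.measurableSet.subtype_image
        (hT ω (measurable_subtype_coe hB)))]
      refine lintegral_congr fun x => ?_
      by_cases hx : (ω, x) ∈ D
      · rw [indicator_of_mem hx, indicator_of_mem ((hsec ω x).1 hx)]
      · rw [indicator_of_notMem hx, indicator_of_notMem (mt (hsec ω x).2 hx)]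
    simp_rw [hfib]
    refine ae_eq_of_forall_setLIntegral_eq_of_sigmaFinite
      ((h.measurable_setLIntegral B).comp σ.measurable)
      (h.measurable_ofReal.indicator hDm).lintegral_prod_right' fun A hA _ => ?_
    -- Invariance of `μ` is applied to the rectangle `σ(A) × B`, whose preimage under the skew
    -- product is `{ω ∈ A, T_ω x ∈ B}`.
    have hA' : MeasurableSet (σ.symm ⁻¹' A) := σ.symm.measurable hA
    have e1 : ∫⁻ ω in A, ∫⁻ x in B, ENNReal.ofReal (H (σ ω) x) ∂volume ∂P =
        μ ((σ.symm ⁻¹' A) ×ˢ (Subtype.val ⁻¹' B)) := by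
      rw [← h.setLIntegral_setLIntegral hA' hB,
        ← hσ.toMeasurePreserving.setLIntegral_comp_preimage hA' (h.measurable_setLIntegral B)]
      congr 2
      ext ω
      simp
    have e2 : ∫⁻ ω in A, ∫⁻ x, D.indicator (fun p => ENNReal.ofReal (H p.1 p.2)) (ω, x) ∂volume ∂P
        = μ (Φ.skewProduct σ ⁻¹' ((σ.symm ⁻¹' A) ×ˢ (Subtype.val ⁻¹' B))) := by
      have : Φ.skewProduct σ ⁻¹' ((σ.symm ⁻¹' A) ×ˢ (Subtype.val ⁻¹' B)) =
          Prod.map id Subtype.val ⁻¹' ((Prod.fst ⁻¹' A) ∩ D) := by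
        ext ⟨ω, x⟩
        simp [hD, skewProduct]
      rw [this, ← h.lintegral_lintegral_indicator ((measurable_fst hA).inter hDm),
        ← lintegral_indicator hA]
      refine lintegral_congr fun ω => ?_
      by_cases hω : ω ∈ A
      · rw [indicator_of_mem hω]
        refine lintegral_congr fun x => ?_
        by_cases hx : (ω, x) ∈ D
        · rw [indicator_of_mem hx,
            indicator_of_mem (show (ω, x) ∈ Prod.fst ⁻¹' A ∩ D from ⟨hω, hx⟩)]
        · rw [indicator_of_notMem hx,
            indicator_of_notMem (show (ω, x) ∉ Prod.fst ⁻¹' A ∩ D from fun h => hx h.2)]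
      · rw [indicator_of_notMem hω]
        simp [indicator, hω]
    change ∫⁻ ω in A, ∫⁻ x in B, ENNReal.ofReal (H (σ ω) x) ∂volume ∂P = _
    rw [e1, e2, hμ.measure_preimage (hA'.prod (measurable_subtype_coe hB)).nullMeasurableSet]
  have hone := h.ae_lintegral_eq_one hσ hμ
  filter_upwards [hΦ, (ae_ball_iff h𝒜c).2 hmain, hone,
    hσ.toMeasurePreserving.quasiMeasurePreserving.ae hone] with ω hreg hB h1 h2
  have hint : Integrable (H ω) := by
    refine ⟨(h.measurable_fiber ω).aestronglyMeasurable, ?_⟩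
    rw [hasFiniteIntegral_iff_ofReal (Filter.Eventually.of_forall (h.nonneg ω)), h1]
    exact ENNReal.one_lt_top
  have hnn : ∀ x, 0 ≤ Φ.transfer ω (H ω) x := fun x => tsum_nonneg fun i =>
    indicator_nonneg (fun _ _ => mul_nonneg (by positivity) (h.nonneg ω _)) x
  have hset : ∀ B ∈ 𝒜, ∫⁻ x in B, ENNReal.ofReal (H (σ ω) x) =
      ∫⁻ x in B, ENNReal.ofReal (Φ.transfer ω (H ω) x) := fun B hBA => by
    rw [hB B hBA, hreg.setLIntegral_transfer hint (h.nonneg ω) _ (hT ω) hC.measurableSet]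
    rw [h𝒜gen]
    exact MeasurableSpace.measurableSet_generateFrom hBA
  have hwd : (volume : Measure (E N)).withDensity (fun x => ENNReal.ofReal (H (σ ω) x)) =
      volume.withDensity (fun x => ENNReal.ofReal (Φ.transfer ω (H ω) x)) := by
    have : IsFiniteMeasure
        ((volume : Measure (E N)).withDensity (fun x => ENNReal.ofReal (H (σ ω) x))) :=
      isFiniteMeasure_withDensity (by rw [h2]; exact ENNReal.one_ne_top)
    have hBm : ∀ B ∈ 𝒜, MeasurableSet B := fun B hBA => by
      rw [h𝒜gen]
      exact MeasurableSpace.measurableSet_generateFrom hBA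
    have hall : ∀ B ∈ 𝒜,
        (volume : Measure (E N)).withDensity (fun x => ENNReal.ofReal (H (σ ω) x)) B =
        volume.withDensity (fun x => ENNReal.ofReal (Φ.transfer ω (H ω) x)) B := fun B hBA => by
      rw [withDensity_apply _ (hBm B hBA), withDensity_apply _ (hBm B hBA), hset B hBA]
    exact ext_of_generate_finite 𝒜 h𝒜gen h𝒜pi hall (hall univ h𝒜univ)
  rw [withDensity_eq_iff (h.measurable_fiber _).ennreal_ofReal.aemeasurable
    (hreg.aestronglyMeasurable_transfer hint).aemeasurable.ennreal_ofReal
    (by rw [h2]; exact ENNReal.one_ne_top)] at hwd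
  filter_upwards [hwd] with x hx
  exact (ENNReal.ofReal_eq_ofReal_iff (h.nonneg _ x) (hnn x)).1 hx

end IsDensity

end BranchedFamily


/-! ### Backward products of the Lasota-Yorke coefficients -/

section BackProd

variable {Ω : Type*} [MeasurableSpace Ω] (σ : Ω ≃ᵐ Ω) (η : Ω → ℝ)

theorem backProd_zero (ω : Ω) : backProd σ η 0 ω = 1 := by
  simp [backProd]

/-- Splits off the factor nearest to `ω`, belonging to the operator applied last; the product
formula itself splits off the farthest one. -/
theorem backProd_succ (j : ℕ) (ω : Ω) :
    backProd σ η (j + 1) ω = η (σ.symm ω) * backProd σ η j (σ.symm ω) := by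
  induction j with
  | zero => simp [backProd]
  | succ j ih =>
    have h : ∀ j ω, backProd σ η (j + 1) ω = backProd σ η j ω * η (σ.symm^[j + 1] ω) :=
      fun j ω => Finset.prod_Icc_succ_top (by omega) _
    rw [h, ih, h j (σ.symm ω), mul_assoc]
    rfl

variable {σ η}

theorem one_le_theta (ξ : ℝ) (j₀ : Ω → ℕ) (ω : Ω) : 1 ≤ theta σ η ξ j₀ ω :=
  (Finset.le_fold_max _).2 (Or.inl le_rfl)

/-- The maximum in `theta` covers `1 ≤ j ≤ j₀`; its entry 1 covers `j = 0` and the later times. -/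
theorem backProd_le_theta_mul_pow {ξ : ℝ} (hξ : 0 < ξ) {j₀ : Ω → ℕ} {ω : Ω}
    (h : ∀ j, 1 ≤ j → j₀ ω ≤ j → backProd σ η j ω < ξ ^ j) (j : ℕ) :
    backProd σ η j ω ≤ theta σ η ξ j₀ ω * ξ ^ j := by
  have h1 := one_le_theta (σ := σ) (η := η) ξ j₀ ω
  have hp := pow_pos hξ j
  rcases Nat.eq_zero_or_pos j with rfl | hj
  · simpa [backProd_zero] using h1
  rcases le_total (j₀ ω) j with hj0 | hj0
  · exact (h j hj hj0).le.trans (le_mul_of_one_le_left hp.le h1)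
  · rw [← div_le_iff₀ hp]
    exact (Finset.le_fold_max _).2 (Or.inr ⟨j, Finset.mem_Icc.2 ⟨hj, hj0⟩, le_rfl⟩)

theorem sum_backProd_le {ξ : ℝ} (hξ : 0 < ξ) (hξ' : ξ < 1) {j₀ : Ω → ℕ} {ω : Ω}
    (h : ∀ j, 1 ≤ j → j₀ ω ≤ j → backProd σ η j ω < ξ ^ j) (n : ℕ) :
    ∑ j ∈ Finset.range n, backProd σ η j ω ≤ theta σ η ξ j₀ ω / (1 - ξ) := by
  have h1 := one_le_theta (σ := σ) (η := η) ξ j₀ ω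
  calc ∑ j ∈ Finset.range n, backProd σ η j ω
      ≤ ∑ j ∈ Finset.range n, theta σ η ξ j₀ ω * ξ ^ j :=
        Finset.sum_le_sum fun j _ => backProd_le_theta_mul_pow hξ h j
    _ = theta σ η ξ j₀ ω * ∑ j ∈ Finset.range n, ξ ^ j := by rw [Finset.mul_sum]
    _ ≤ theta σ η ξ j₀ ω * (1 - ξ)⁻¹ := by
        gcongr
        rw [← tsum_geometric_of_lt_one hξ.le hξ']
        exact (summable_geometric_of_lt_one hξ.le hξ').sum_le_tsum _ fun _ _ => by positivity
    _ = _ := by rw [div_eq_mul_inv]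

end BackProd

/-! ### Bounded oscillation of the fibre densities -/

namespace BranchedFamily

variable {Ω ι : Type*} {N : ℕ} {C : Set (E N)}

theorem RegularFiber.memV_transfer [Countable ι] {Φ : BranchedFamily Ω ι C} {ω : Ω} {α e : ℝ}
    (h : Φ.RegularFiber ω) {f : E N → ℝ} (hf : MemV C α e f)
    (hfin : oscNorm α e (Φ.transfer ω f) < ∞) : MemV C α e (Φ.transfer ω f) :=
  ⟨h.integrable_transfer hf.integrable,
    Filter.Eventually.of_forall fun _ hx => h.transfer_eq_zero f hx,
    (self_le_add_left _ _).trans_lt hfin⟩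

theorem _root_.Saussol.MemV.eLpNorm_lt_top {α e : ℝ} {f : E N → ℝ} (hf : MemV C α e f) :
    eLpNorm f 1 volume < ∞ :=
  (memLp_one_iff_integrable.2 hf.integrable).2

theorem _root_.Saussol.MemV.oscNorm_lt_top {α e : ℝ} {f : E N → ℝ} (hf : MemV C α e f) :
    oscNorm α e f < ∞ :=
  ENNReal.add_lt_top.2 ⟨hf.eLpNorm_lt_top, hf.finite⟩

/-- Iterating the Lasota-Yorke inequality along the backward orbit of `ω`, while tracking the
distance to a family of functions that the transfer operators map to each other. -/
theorem exists_iterate_transfer [Countable ι] [MeasurableSpace Ω] {Φ : BranchedFamily Ω ι C}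
    {σ : Ω ≃ᵐ Ω} {α e : ℝ} {η : Ω → ℝ} (hη : ∀ ω, 0 < η ω) {D : ℝ} {H : Ω → E N → ℝ} (n : ℕ)
    (ω : Ω) (hreg : ∀ m, Φ.RegularFiber (σ.symm^[m + 1] ω))
    (hLY : ∀ m, ∀ f, MemV C α e f → oscNorm α e (Φ.transfer (σ.symm^[m + 1] ω) f) ≤
      ENNReal.ofReal (η (σ.symm^[m + 1] ω)) * oscNorm α e f +
        ENNReal.ofReal D * eLpNorm f 1 volume)
    (hint : ∀ m, Integrable (H (σ.symm^[m + 1] ω)))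
    (htr : ∀ m, H (σ.symm^[m] ω) =ᵐ[volume] Φ.transfer (σ.symm^[m + 1] ω) (H (σ.symm^[m + 1] ω)))
    {φ : E N → ℝ} (hφ : MemV C α e φ) :
    ∃ u, MemV C α e u ∧ oscNorm α e u ≤ ENNReal.ofReal (backProd σ η n ω) * oscNorm α e φ +
        ENNReal.ofReal D * ENNReal.ofReal (∑ j ∈ Finset.range n, backProd σ η j ω) *
          eLpNorm φ 1 volume ∧
      eLpNorm u 1 volume ≤ eLpNorm φ 1 volume ∧
      eLpNorm (H ω - u) 1 volume ≤ eLpNorm (H (σ.symm^[n] ω) - φ) 1 volume := by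
  have hbp : ∀ j ω, 0 ≤ backProd σ η j ω := fun j ω => Finset.prod_nonneg fun _ _ => (hη _).le
  induction n generalizing ω with
  | zero => exact ⟨φ, hφ, by simp [backProd_zero], le_rfl, le_rfl⟩
  | succ n ih =>
    obtain ⟨v, hv, hvn, hv1, hvH⟩ := ih (σ.symm ω) (fun m => hreg (m + 1)) (fun m => hLY (m + 1))
      (fun m => hint (m + 1)) (fun m => htr (m + 1))
    have hr : Φ.RegularFiber (σ.symm ω) := hreg 0
    have hLY0 := hLY 0 v hv
    simp only [zero_add, Function.iterate_one] at hLY0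
    have hfin : oscNorm α e (Φ.transfer (σ.symm ω) v) < ∞ :=
      hLY0.trans_lt (ENNReal.add_lt_top.2
        ⟨ENNReal.mul_lt_top ENNReal.ofReal_lt_top hv.oscNorm_lt_top,
          ENNReal.mul_lt_top ENNReal.ofReal_lt_top hv.eLpNorm_lt_top⟩)
    refine ⟨Φ.transfer (σ.symm ω) v, hr.memV_transfer hv hfin, ?_,
      (hr.eLpNorm_transfer_le hv.integrable).trans hv1, ?_⟩
    · calc oscNorm α e (Φ.transfer (σ.symm ω) v)
          ≤ ENNReal.ofReal (η (σ.symm ω)) *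
              (ENNReal.ofReal (backProd σ η n (σ.symm ω)) * oscNorm α e φ +
                ENNReal.ofReal D *
                  ENNReal.ofReal (∑ j ∈ Finset.range n, backProd σ η j (σ.symm ω)) *
                  eLpNorm φ 1 volume) + ENNReal.ofReal D * eLpNorm φ 1 volume :=
            hLY0.trans (by gcongr)
        _ = _ := by
            -- The new term `D ‖φ‖_{L¹}` is the `j = 0` summand; multiplication by `η(σ⁻¹ω)` shifts
            -- the other summands by one.
            rw [Finset.sum_range_succ', backProd_zero]
            simp_rw [backProd_succ]
            rw [← Finset.mul_sum, ENNReal.ofReal_add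
              (mul_nonneg (hη _).le (Finset.sum_nonneg fun _ _ => hbp _ _)) zero_le_one,
              ENNReal.ofReal_mul (hη _).le, ENNReal.ofReal_mul (hη _).le, ENNReal.ofReal_one]
            ring
    · have h1 : H ω - Φ.transfer (σ.symm ω) v =ᵐ[volume]
          Φ.transfer (σ.symm ω) (H (σ.symm ω) - v) :=
        ((htr 0).sub Filter.EventuallyEq.rfl).trans
          (hr.transfer_sub (hint 0) hv.integrable).symm
      rw [eLpNorm_congr_ae h1]
      exact (hr.eLpNorm_transfer_le ((hint 0).sub hv.integrable)).trans hvH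

/-- The fibre densities of an invariant measure are of bounded oscillation, with a bound that comes
from the Lasota-Yorke inequality. -/
theorem IsDensity.ae_oscSeminorm_le [Countable ι] [MeasurableSpace Ω] {P : Measure Ω}
    [IsProbabilityMeasure P] {μ : Measure (Ω × C)} {H : Ω → E N → ℝ} (h : IsDensity P μ H)
    {Φ : BranchedFamily Ω ι C} {σ : Ω ≃ᵐ Ω} (hC : IsCompact C) (hσ : Ergodic σ P)
    [IsProbabilityMeasure μ] (hμ : MeasurePreserving (Φ.skewProduct σ) μ μ)
    (hΦ : ∀ᵐ ω ∂P, Φ.RegularFiber ω) {α e : ℝ} (hα' : α ≤ 1) {η : Ω → ℝ} (hη : ∀ ω, 0 < η ω)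
    {D ξ : ℝ} (hD : 0 ≤ D) {j₀ : Ω → ℕ} (hLY : Φ.LasotaYorke P α e η D) (hξ : 0 < ξ) (hξ' : ξ < 1)
    (hj₀ : ∀ᵐ ω ∂P, ∀ j, 1 ≤ j → j₀ ω ≤ j → backProd σ η j ω < ξ ^ j) :
    ∀ᵐ ω ∂P, oscSeminorm α e (H ω) ≤ ENNReal.ofReal (D * (theta σ η ξ j₀ ω / (1 - ξ))) := by
  -- The open pieces lie in the interior of `C` and cover almost all of `C`.
  have hCi : volume (C \ interior C) = 0 := by
    obtain ⟨ω, hω⟩ := hΦ.exists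
    refine measure_mono_null (sdiff_subset_sdiff_right ?_) hω.covers
    exact iUnion_subset fun i => (hω.isOpen_U i).subset_interior_iff.2 (hω.U_subset i)
  obtain ⟨φ, hφm, hφ, hφd⟩ := exists_dense_seq_memV hC hCi e hα'
  have hσ' : MeasurePreserving σ.symm P P := hσ.toMeasurePreserving.symm σ
  have horbit : ∀ {p : Ω → Prop}, (∀ᵐ ω ∂P, p ω) → ∀ᵐ ω ∂P, ∀ m, p (σ.symm^[m] ω) :=
    fun hp => ae_all_iff.2 fun m => (hσ'.iterate m).quasiMeasurePreserving.ae hp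
  -- Poincaré recurrence for `σ⁻¹`, applied to the countably many sets of `ω` whose density is
  -- within `1/(l+1)` of `φ k`.
  have hrec : ∀ᵐ ω ∂P, ∀ (k : ℕ) (l : ℕ),
      eLpNorm (H ω - φ k) 1 volume < ENNReal.ofReal (1 / (l + 1)) →
        ∃ᶠ n in Filter.atTop,
          eLpNorm (H (σ.symm^[n] ω) - φ k) 1 volume < ENNReal.ofReal (1 / (l + 1)) := by
    refine ae_all_iff.2 fun k => ae_all_iff.2 fun l => ?_
    have hm : Measurable fun ω => eLpNorm (H ω - φ k) 1 volume := by
      simp_rw [eLpNorm_one_eq_lintegral_enorm]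
      exact ((h.measurable.sub ((hφm k).comp measurable_snd)).enorm).lintegral_prod_right'
    exact hσ'.conservative.ae_mem_imp_frequently_image_mem
      (measurableSet_lt hm measurable_const).nullMeasurableSet
  have hone := h.ae_lintegral_eq_one hσ hμ
  have htr := h.ae_eq_transfer hC hσ hμ hΦ
  filter_upwards [hrec, hj₀, horbit hone, horbit htr, horbit hΦ, horbit hLY]
    with ω hrec hj₀ hone htr hreg hLY
  have hnorm : ∀ m, eLpNorm (H (σ.symm^[m] ω)) 1 volume = 1 := fun m => by
    rw [eLpNorm_one_eq_lintegral_enorm, ← hone m]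
    exact lintegral_congr fun x => Real.enorm_of_nonneg (h.nonneg _ _)
  have hint : ∀ m, Integrable (H (σ.symm^[m] ω)) := fun m =>
    memLp_one_iff_integrable.1 ⟨(h.measurable_fiber _).aestronglyMeasurable, by
      rw [hnorm m]
      exact ENNReal.one_lt_top⟩
  have htr' : ∀ m, H (σ.symm^[m] ω) =ᵐ[volume]
      Φ.transfer (σ.symm^[m + 1] ω) (H (σ.symm^[m + 1] ω)) := fun m => by
    have := htr (m + 1)
    rwa [Function.iterate_succ_apply', MeasurableEquiv.apply_symm_apply,
      ← Function.iterate_succ_apply' (f := σ.symm)] at this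
  set M := D * (theta σ η ξ j₀ ω / (1 - ξ)) with hM
  have hθ := one_le_theta (σ := σ) (η := η) ξ j₀ ω
  have hM0 : 0 ≤ M := mul_nonneg hD (div_nonneg (by linarith) (by linarith))
  have happrox : ∀ l : ℕ, ∃ u, MemV C α e u ∧
      oscNorm α e u ≤ ENNReal.ofReal (1 / (l + 1) + M * (1 + 1 / (l + 1))) ∧
      eLpNorm (u - H ω) 1 volume ≤ ENNReal.ofReal (1 / (l + 1)) := by
    intro l
    have hl : (0 : ℝ) < 1 / (l + 1) := Nat.one_div_pos_of_nat
    obtain ⟨k, hk⟩ := hφd (H ω) (hint 0) (Filter.Eventually.of_forall fun x => h.eq_zero ω x) _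
      (ENNReal.ofReal_pos.2 hl)
    have hsmall : Filter.Tendsto (fun n : ℕ =>
        ENNReal.ofReal (theta σ η ξ j₀ ω * ξ ^ n) * oscNorm α e (φ k)) Filter.atTop (𝓝 0) := by
      have h1 : Filter.Tendsto (fun n : ℕ => theta σ η ξ j₀ ω * ξ ^ n) Filter.atTop (𝓝 0) := by
        simpa using (tendsto_pow_atTop_nhds_zero_of_lt_one hξ.le hξ').const_mul
          (theta σ η ξ j₀ ω)
      have h2 := ENNReal.tendsto_ofReal h1
      rw [ENNReal.ofReal_zero] at h2
      simpa using ENNReal.Tendsto.mul_const h2 (Or.inr (hφ k).oscNorm_lt_top.ne)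
    -- Since `k` is already fixed, `‖φ k‖_α` does not grow with `n`, and recurrence supplies an `n`
    -- large enough to make its contribution small.
    obtain ⟨n, hn, hn'⟩ := ((hrec k l hk).and_eventually
      (hsmall.eventually_le_const (ENNReal.ofReal_pos.2 hl))).exists
    obtain ⟨u, hu, hun, -, huH⟩ := exists_iterate_transfer hη (D := D) n ω
      (fun m => hreg (m + 1)) (fun m => hLY (m + 1)) (fun m => hint (m + 1)) htr' (hφ k)
    refine ⟨u, hu, hun.trans ?_, ?_⟩
    · have hφ1 : eLpNorm (φ k) 1 volume ≤ ENNReal.ofReal (1 + 1 / (l + 1)) := by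
        rw [ENNReal.ofReal_add zero_le_one hl.le, ENNReal.ofReal_one]
        calc eLpNorm (φ k) 1 volume
            = eLpNorm (H (σ.symm^[n] ω) - (H (σ.symm^[n] ω) - φ k)) 1 volume := by
              rw [sub_sub_cancel]
          _ ≤ eLpNorm (H (σ.symm^[n] ω)) 1 volume +
                eLpNorm (H (σ.symm^[n] ω) - φ k) 1 volume :=
              eLpNorm_sub_le (hint n).aestronglyMeasurable
                ((hint n).sub (hφ k).integrable).aestronglyMeasurable le_rfl
          _ ≤ _ := by
              rw [hnorm n]
              gcongr
      rw [ENNReal.ofReal_add hl.le (by positivity)]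
      gcongr
      · exact (mul_le_mul_left (ENNReal.ofReal_le_ofReal
          (backProd_le_theta_mul_pow hξ hj₀ n)) _).trans hn'
      · rw [ENNReal.ofReal_mul hM0, hM, ENNReal.ofReal_mul hD]
        gcongr
        exact sum_backProd_le hξ hξ' hj₀ n
    · rw [eLpNorm_sub_comm]
      exact huH.trans hn.le
  choose u hu hun huH using happrox
  have hlim : Filter.Tendsto (fun l : ℕ => (1 : ℝ) / (l + 1)) Filter.atTop (𝓝 0) :=
    tendsto_one_div_add_atTop_nhds_zero_nat
  -- The lower semicontinuity requires almost-everywhere convergence, available along a subsequence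
  -- of the `L¹`-convergent `u`.
  have hmeas : TendstoInMeasure volume u Filter.atTop (H ω) := by
    refine tendstoInMeasure_of_tendsto_eLpNorm one_ne_zero
      (fun l => (hu l).integrable.aestronglyMeasurable) (hint 0).aestronglyMeasurable ?_
    refine tendsto_of_tendsto_of_tendsto_of_le_of_le tendsto_const_nhds ?_
      (fun _ => bot_le) huH
    simpa using ENNReal.tendsto_ofReal hlim
  obtain ⟨ns, hns, hae⟩ := hmeas.exists_seq_tendsto_ae
  have hlim2 : Filter.Tendsto (fun l : ℕ =>
      ENNReal.ofReal (1 / ((ns l : ℕ) + 1) + M * (1 + 1 / ((ns l : ℕ) + 1)))) Filter.atTop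
      (𝓝 (ENNReal.ofReal M)) := by
    refine ENNReal.tendsto_ofReal ?_
    have h1 := hlim.comp hns.tendsto_atTop
    simpa using h1.add ((h1.const_add 1).const_mul M)
  calc oscSeminorm α e (H ω)
      ≤ Filter.liminf (fun l => oscSeminorm α e (u (ns l))) Filter.atTop :=
        oscSeminorm_le_liminf hae
    _ ≤ Filter.liminf (fun l : ℕ =>
          ENNReal.ofReal (1 / ((ns l : ℕ) + 1) + M * (1 + 1 / ((ns l : ℕ) + 1)))) Filter.atTop :=
        Filter.liminf_le_liminf (Filter.Eventually.of_forall fun l =>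
          (self_le_add_left _ _).trans (hun (ns l)))
    _ = ENNReal.ofReal M := hlim2.liminf_eq

end BranchedFamily


/-! ### Packing disjoint balls into `C` -/

/-- Since `θ/(1-ξ) ≥ 1` and `m(C) ≥ 1`, one has `Θ ≥ 2D ≥ 2ξ e^{-α}`, and `ξ > 1/2` puts the radius
`Θ^{-1/α}` within the admissible scales. The summand 1 in `Θ` makes the second inequality strict. -/
theorem rpow_neg_le_bigTheta {Ω : Type*} [MeasurableSpace Ω] {N : ℕ} {C : Set (E N)}
    {σ : Ω ≃ᵐ Ω} {η : Ω → ℝ} {α e D ξ : ℝ} (he : 0 < e) (hmC : 1 ≤ volume.real C)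
    (hξ : 1 / 2 < ξ) (hξ' : ξ < 1) (hD : ξ * e ^ (-α) ≤ D) (j₀ : Ω → ℕ) (ω : Ω) :
    e ^ (-α) ≤ bigTheta C σ η D ξ j₀ ω ∧
      D * (theta σ η ξ j₀ ω / (1 - ξ)) < bigTheta C σ η D ξ j₀ ω := by
  have hep : 0 < e ^ (-α) := Real.rpow_pos_of_pos he _
  have hD0 : 0 < D := (mul_pos (by linarith) hep).trans_le hD
  have hθ := one_le_theta (σ := σ) (η := η) ξ j₀ ω
  have h1 : 1 ≤ theta σ η ξ j₀ ω / (1 - ξ) := (one_le_div (by linarith)).2 (by linarith)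
  have h2 : D * (1 + theta σ η ξ j₀ ω / (1 - ξ)) ≤ bigTheta C σ η D ξ j₀ ω := by
    unfold bigTheta
    gcongr
    exact le_mul_of_one_le_right hD0.le hmC
  constructor
  · nlinarith
  · linarith

/-- Functions that are positive on balls of radius `ρ`, have pairwise disjoint supports, and vanish
outside `C`, are at most `m(C) / m(B_ρ)` many. -/
theorem card_mul_volume_ball_le {κ : Type*} {N : ℕ} {C : Set (E N)} (F : Finset κ)
    {f : κ → E N → ℝ} {ρ : ℝ} (hf0 : ∀ k ∈ F, ∀ x, x ∉ C → f k x = 0)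
    (hpos : ∀ k ∈ F, ∃ x, ∀ᵐ y ∂volume.restrict (Metric.ball x ρ), 0 < f k y)
    (hdisj : ∀ k ∈ F, ∀ l ∈ F, k ≠ l → ∀ᵐ y, f k y = 0 ∨ f l y = 0) :
    F.card * volume (Metric.ball (0 : E N) ρ) ≤ volume C := by
  choose! x hx using hpos
  have hx' : ∀ k ∈ F, ∀ᵐ y, y ∈ Metric.ball (x k) ρ → 0 < f k y := fun k hk =>
    (ae_restrict_iff' Metric.isOpen_ball.measurableSet).1 (hx k hk)
  calc (F.card : ℝ≥0∞) * volume (Metric.ball (0 : E N) ρ)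
      = ∑ k ∈ F, volume (Metric.ball (x k) ρ) := by
        simp [Measure.addHaar_ball_center]
    _ = volume (⋃ k ∈ F, Metric.ball (x k) ρ) := by
        refine (measure_biUnion_finset₀ (fun k hk l hl hkl => ?_)
          fun k _ => Metric.isOpen_ball.measurableSet.nullMeasurableSet).symm
        refine measure_eq_zero_iff_ae_notMem.2 ?_
        filter_upwards [hx' k hk, hx' l hl, hdisj k hk l hl hkl] with y h1 h2 h3 hy
        rcases h3 with h3 | h3
        · exact (h1 hy.1).ne' h3
        · exact (h2 hy.2).ne' h3
    _ ≤ volume C := by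
        refine measure_mono_ae ?_
        have : ∀ᵐ y, ∀ k ∈ F, y ∈ Metric.ball (x k) ρ → 0 < f k y :=
          (ae_ball_iff F.countable_toSet).2 hx'
        filter_upwards [this] with y hy hyU
        obtain ⟨k, hk, hyk⟩ := mem_iUnion₂.1 hyU
        by_contra hyC
        exact (hy k hk hyk).ne' (hf0 k hk y hyC)

/-- Stated for finite subfamilies, so that finiteness of the whole set can be deduced from it and
only countably many null sets of `ω` are discarded. -/
theorem BranchedFamily.ae_card_le {Ω ι : Type*} [TopologicalSpace Ω] [MeasurableSpace Ω]
    [Countable ι] {P : Measure Ω} [IsProbabilityMeasure P] {σ : Ω ≃ᵐ Ω} (hσ : Ergodic σ P)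
    {N : ℕ} {C : Set (E N)} (hC : IsCompact C) {α ε₀ e : ℝ} (hα : 0 < α) (hα' : α ≤ 1)
    (he : 0 < e) {s : Ω → ℝ} {S c : ℝ} {Φ : BranchedFamily Ω ι C}
    (hΦ : Φ.IsRandomSaussol P α ε₀ e s S c) (hmC : 1 ≤ volume.real C) {Θ : Ω → ℝ}
    (hΘ : IsTheta Φ P σ α e Θ) {F : Finset (Measure (Ω × C))}
    (hF : (F : Set (Measure (Ω × C))) ⊆ Φ.ergodicACIPs σ P) :
    ∀ᵐ ω ∂P, (F.card : ℝ) ≤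
      volume.real C / volume.real (Metric.ball (0 : E N) 1) * Θ ω ^ ((N : ℝ) / α) := by
  obtain ⟨η, D, ξ, j₀, -, hη, hLY, hξ, hξ', hD, -, hj₀, rfl⟩ := hΘ
  have hreg := hΦ.ae_regularFiber
  have hD0 : 0 ≤ D := (mul_pos (by linarith) (Real.rpow_pos_of_pos he _)).le.trans hD
  have hex : ∀ μ ∈ F, ∃ H, IsDensity P μ H := fun μ hμ =>
    have := (hF hμ).1
    exists_isDensity hC (hF hμ).2.2
  choose! H hH using hex
  have hosc : ∀ᵐ ω ∂P, ∀ μ ∈ F, oscSeminorm α e (H μ ω) ≤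
      ENNReal.ofReal (D * (theta σ η ξ j₀ ω / (1 - ξ))) :=
    (ae_ball_iff F.countable_toSet).2 fun μ hμ =>
      have := (hF hμ).1
      (hH μ hμ).ae_oscSeminorm_le hC hσ (hF hμ).2.1.toMeasurePreserving hreg hα' hη hD0 hLY
        (by linarith) hξ' hj₀
  have hone : ∀ᵐ ω ∂P, ∀ μ ∈ F, ∫⁻ x, ENNReal.ofReal (H μ ω x) = 1 :=
    (ae_ball_iff F.countable_toSet).2 fun μ hμ =>
      have := (hF hμ).1
      (hH μ hμ).ae_lintegral_eq_one hσ (hF hμ).2.1.toMeasurePreserving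
  have hdisj : ∀ᵐ ω ∂P, ∀ μ ∈ F, ∀ ν ∈ F, μ ≠ ν → ∀ᵐ x, H μ ω x = 0 ∨ H ν ω x = 0 := by
    refine (ae_ball_iff F.countable_toSet).2 fun μ hμ =>
      (ae_ball_iff F.countable_toSet).2 fun ν hν => ?_
    by_cases hne : μ = ν
    · exact Filter.Eventually.of_forall fun ω h => absurd hne h
    have := (hF hμ).1
    have := (hF hν).1
    filter_upwards [(hH μ hμ).ae_ae_eq_zero_or_eq_zero hC (hH ν hν)
      ((hF hμ).2.1.mutuallySingular_of_ne (hF hν).2.1 hne)] with ω hω _ using hω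
  filter_upwards [hosc, hone, hdisj] with ω hosc hone hdisj
  obtain ⟨h1, h2⟩ := rpow_neg_le_bigTheta (C := C) (σ := σ) (η := η) he hmC hξ hξ' hD j₀ ω
  set T := bigTheta C σ η D ξ j₀ ω
  have hT : 0 < T := (Real.rpow_pos_of_pos he _).trans_le h1
  have hρ : 0 < T ^ (-1 / α) := Real.rpow_pos_of_pos hT _
  have hcard := card_mul_volume_ball_le F (ρ := T ^ (-1 / α))
    (fun μ hμ x => (hH μ hμ).eq_zero ω x)
    (fun μ hμ => exists_ball_ae_pos_of_oscSeminorm_lt hα he h1 (hone μ hμ)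
      ((hosc μ hμ).trans_lt ((ENNReal.ofReal_lt_ofReal_iff hT).2 h2))) hdisj
  rw [Measure.addHaar_ball_of_pos _ _ hρ, finrank_euclideanSpace, Fintype.card_fin] at hcard
  have hcard' := ENNReal.toReal_mono hC.measure_lt_top.ne hcard
  have hγ : 0 < volume.real (Metric.ball (0 : E N) 1) :=
    ENNReal.toReal_pos (Metric.measure_ball_pos _ _ one_pos).ne' measure_ball_lt_top.ne
  rw [ENNReal.toReal_mul, ENNReal.toReal_mul, ENNReal.toReal_natCast,
    ENNReal.toReal_ofReal (by positivity)] at hcard'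
  change (F.card : ℝ) * ((T ^ (-1 / α)) ^ N * volume.real (Metric.ball (0 : E N) 1)) ≤
    volume.real C at hcard'
  have hpow : (T ^ (-1 / α)) ^ N * T ^ ((N : ℝ) / α) = 1 := by
    rw [← Real.rpow_natCast, ← Real.rpow_mul hT.le, ← Real.rpow_add hT,
      show -1 / α * N + N / α = 0 by ring, Real.rpow_zero]
  have hTp : 0 < T ^ ((N : ℝ) / α) := Real.rpow_pos_of_pos hT _
  rw [div_mul_eq_mul_div, le_div_iff₀ hγ]
  calc (F.card : ℝ) * volume.real (Metric.ball (0 : E N) 1)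
      = F.card * ((T ^ (-1 / α)) ^ N * volume.real (Metric.ball (0 : E N) 1)) *
          T ^ ((N : ℝ) / α) := by
        linear_combination (-(F.card : ℝ) * volume.real (Metric.ball (0 : E N) 1)) * hpow
    _ ≤ _ := by gcongr

/-- A real function is bounded on a set of positive measure. -/
theorem exists_frequently_le {Ω : Type*} [MeasurableSpace Ω] {P : Measure Ω} [NeZero P]
    (f : Ω → ℝ) : ∃ K : ℝ, ∃ᶠ ω in ae P, f ω ≤ K := by
  by_contra! h
  have h1 : ∀ᵐ ω ∂P, ∀ n : ℕ, ¬ f ω ≤ n :=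
    ae_all_iff.2 fun n => by simpa [Filter.not_frequently] using h n
  obtain ⟨ω, hω⟩ := h1.exists
  obtain ⟨n, hn⟩ := exists_nat_ge (f ω)
  exact hω n hn

/-- In `ℝ` an essential infimum is meaningful only with a coboundedness condition, here supplied by
an upper bound for `f` on a non-null set. -/
theorem le_essInf_real {Ω : Type*} [MeasurableSpace Ω] {P : Measure Ω} [NeZero P]
    {f : Ω → ℝ} {a : ℝ} (h : ∀ᵐ ω ∂P, a ≤ f ω) : a ≤ essInf f P := by
  obtain ⟨K, hK⟩ := exists_frequently_le (P := P) f
  exact Filter.le_liminf_of_le (Filter.IsCoboundedUnder.of_frequently_le hK) h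

end Saussol

theorem theorem6p1
    {Ω ι : Type*} [TopologicalSpace Ω] [MeasurableSpace Ω] [BorelSpace Ω] [Countable ι]
    (P : Measure Ω) [IsProbabilityMeasure P]
    (σ : Ω ≃ᵐ Ω) (hσ : Ergodic σ P)
    (N : ℕ) (hN : 1 < N)
    (C : Set (Saussol.E N)) (hC : IsCompact C) (hC' : (closure (interior C)).Nonempty)
    (α ε₀ e : ℝ) (hα : 0 < α) (hα' : α ≤ 1) (hε₀ : 0 < ε₀) (he : 0 < e)
    (s : Ω → ℝ) (S c : ℝ)
    (Φ : Saussol.BranchedFamily Ω ι C) (hΦ : Φ.IsRandomSaussol P α ε₀ e s S c)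
    (hlog : ∫⁻ ω, (ENNReal.log (Φ.transferNorm α e ω)).toENNReal ∂P < ∞)
    (hmC : 1 ≤ volume.real C)
    (Θ : Ω → ℝ) (hΘ : Saussol.IsTheta Φ P σ α e Θ) :
    (Φ.ergodicACIPs σ P).Finite ∧
      ((Φ.ergodicACIPs σ P).ncard : ℝ) ≤
        volume.real C / volume.real (Metric.ball (0 : Saussol.E N) 1) *
          essInf (fun ω => Θ ω ^ ((N : ℝ) / α)) P := by
  have hγ : 0 < volume.real (Metric.ball (0 : Saussol.E N) 1) :=
    ENNReal.toReal_pos (Metric.measure_ball_pos _ _ one_pos).ne' measure_ball_lt_top.ne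
  have hq : 0 < volume.real C / volume.real (Metric.ball (0 : Saussol.E N) 1) :=
    div_pos (by linarith) hγ
  have hcard := fun (F : Finset (Measure (Ω × C)))
      (hF : (F : Set (Measure (Ω × C))) ⊆ Φ.ergodicACIPs σ P) =>
    Saussol.BranchedFamily.ae_card_le hσ hC hα hα' he hΦ hmC hΘ hF
  have hfin : (Φ.ergodicACIPs σ P).Finite := by
    by_contra hinf
    -- The null set in `hcard` depends on `F`, but `K` is chosen beforehand: a subfamily with more
    -- than `K` members contradicts the bound at some `ω`.
    obtain ⟨K, hK⟩ := Saussol.exists_frequently_le (P := P) fun ω =>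
      volume.real C / volume.real (Metric.ball (0 : Saussol.E N) 1) * Θ ω ^ ((N : ℝ) / α)
    obtain ⟨n, hn⟩ := exists_nat_gt K
    obtain ⟨F, hF, hFn⟩ := Set.Infinite.exists_subset_card_eq hinf n
    obtain ⟨ω, h1, h2⟩ := (hK.and_eventually (hcard F hF)).exists
    rw [hFn] at h2
    linarith
  refine ⟨hfin, ?_⟩
  rw [Set.ncard_eq_toFinset_card _ hfin, mul_comm, ← div_le_iff₀ hq]
  refine Saussol.le_essInf_real ?_
  filter_upwards [hcard hfin.toFinset (by simp)] with ω hω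
  rwa [div_le_iff₀ hq, mul_comm]
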